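/- Let $p\ge 5$ be a prime, $q=p^n$ a power of $p$ ($n\ge 1$), and let $S$ be a group isomorphic to a Sylow $p$-subgroup of $\mathrm{G}_2(q)$. Write $Z_i(S)$ for the $i$-th term of the upper central series of $S$ (so $Z_1(S)=Z(S)$), $S'$ for the derived subgroup of $S$, $\Phi(E)$ for the Frattini subgroup of $E$, and put \[Q_1:=C_S(Z_3(S)/Z(S)),\qquad Q_2:=C_S(Z_2(S)).\] A subgroup $E\le S$ is called $S$-centric if $C_S(E)=Z(E)$, and $S$-radical if $O_p(\mathrm{Out}(E))\cap \mathrm{Out}_S(E)=\{1\}$, where $\mathrm{Out}_S(E)$ is the image of $N_S(E)$ in $\mathrm{Out}(E)=\mathrm{Aut}(E)/\mathrm{Inn}(E)$. Let $q^{1+2}$ denote a group isomorphic to a Sylow $p$-subgroup of $\mathrm{SL}_3(q)$. Suppose that $E$ is an $S$-centric, $S$-radical subgroup of $S$. Then one of the following holds: \begin{enumerate} \item[(i)] $E\in\{Q_1,Q_2,S\}$; \item[(ii)] $E\le Q_2$ has order $q^4$, $\Phi(E)<Z_2(S)=Z(E)$, $|\Phi(E)|=q$ and $N_S(E)=Q_2$;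 \item[(iii)] $E\le S'$ is elementary abelian of order $q^3$, with $E\trianglelefteq S$ if $E=Z_3(S)$, and $N_S(E)=Q_1$ otherwise; \item[(iv)] $E\le Q_2$ is elementary abelian of order $q^3$, $E\not\le S'$ and $N_S(E)=EZ_3(S)$ has order $q^4$; \item[(v)] $E\cong q^{1+2}$, $Z_2(S)=E\cap Q_1=E\cap Q_2$ and $Z(S)=Z(E)=\Phi(E)$; \item[(vi)] $E\le Q_1$ is elementary abelian of order $q^3$, $E\cap Z_2(S)=Z(S)$ and $N_S(E)=Q_1$; or \item[(vii)] $p\ge 7$, $E$ is elementary abelian of order $q^2$, $Z(S)=E\cap Q_1=E\cap Q_2$ and $N_S(E)=EZ_2(S)$ has order $q^3$. \end{enumerate} -/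

import Mathlib

open scoped Matrix

section SplitOctonions

variable (K : Type*) [Field K]

/-- The underlying vector space of the split octonion algebra over `K` (of dimension `8`).
The tuple `(a, u, v, b)` is the Zorn vector matrix with diagonal entries the scalars `a`, `b` and
off-diagonal entries the vectors `u` (top right) and `v` (bottom left). -/
abbrev ZornMatrix : Type _ := K × (Fin 3 → K) × (Fin 3 → K) × K

variable {K}

/-- Multiplication of Zorn vector matrices. -/
def ZornMatrix.mul : ZornMatrix K → ZornMatrix K → ZornMatrix K :=
  fun (a, u, v, b) (a', u', v', b') =>
    (a * a' + u ⬝ᵥ v',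
     a • u' + b' • u + crossProduct v v',
     a' • v + b • v' - crossProduct u u',
     b * b' + v ⬝ᵥ u')

variable (K)

/-- The group `G₂(K)`, as the group of `K`-algebra automorphisms of the split octonion algebra. -/
def G2 : Subgroup (ZornMatrix K ≃ₗ[K] ZornMatrix K) where
  carrier := {g | ∀ x y, g (ZornMatrix.mul x y) = ZornMatrix.mul (g x) (g y)}
  one_mem' := fun _ _ => rfl
  mul_mem' := fun {g h} hg hh x y => by
    change g (h _) = ZornMatrix.mul (g (h x)) (g (h y))
    rw [hh, hg]
  inv_mem' := fun {g} hg x y => by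
    apply g.injective
    change g (g.symm _) = g (ZornMatrix.mul (g.symm x) (g.symm y))
    rw [hg]
    simp only [LinearEquiv.apply_symm_apply]

end SplitOctonions

section GroupTheory

variable {G : Type*} [Group G]

/-- `O_p(G)`: the subgroup generated by all normal `p`-subgroups of `G`
(for finite `G`, the largest normal `p`-subgroup). -/
def Op (p : ℕ) (G : Type*) [Group G] : Subgroup G :=
  sSup {N : Subgroup G | N.Normal ∧ IsPGroup p N}

/-- `Inn(G)`, as a subgroup of `Aut(G)`. -/
def Inn (G : Type*) [Group G] : Subgroup (MulAut G) := (MulAut.conj : G →* MulAut G).range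

instance Inn.normal (G : Type*) [Group G] : (Inn G).Normal := by
  constructor
  rintro _ ⟨x, rfl⟩ φ
  refine ⟨φ x, ?_⟩
  ext y
  simp [MulAut.conj_apply]

/-- `Out(G) = Aut(G) / Inn(G)`. -/
abbrev Out (G : Type*) [Group G] : Type _ := MulAut G ⧸ Inn G

/-- `Out_G(E)`: the image in `Out(E)` of `N_G(E)`, acting on `E` by conjugation. -/
def OutIn (E : Subgroup G) : Subgroup (Out E) :=
  E.normalizerMonoidHom.range.map (QuotientGroup.mk' (Inn E))

/-- `Z(E)`, as a subgroup of the ambient group. -/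
def centerIn (E : Subgroup G) : Subgroup G := (Subgroup.center E).map E.subtype

/-- The Frattini subgroup `Φ(E)`, as a subgroup of the ambient group. -/
def frattiniIn (E : Subgroup G) : Subgroup G := (frattini E).map E.subtype

/-- `E ≤ S` is `S`-centric: `C_S(E) = Z(E)`. -/
def IsCentricIn (E : Subgroup G) : Prop :=
  Subgroup.centralizer (E : Set G) = centerIn E

/-- `E ≤ S` is `S`-radical: `O_p(Out(E)) ∩ Out_S(E) = 1`. -/
def IsRadicalIn (p : ℕ) (E : Subgroup G) : Prop :=
  Op p (Out E) ⊓ OutIn E = ⊥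

/-- `E` is an elementary abelian `p`-group. -/
def IsElemAbelian (p : ℕ) (E : Subgroup G) : Prop :=
  (∀ x ∈ E, ∀ y ∈ E, x * y = y * x) ∧ ∀ x ∈ E, x ^ p = 1

/-- `Z_i(S)`, the `i`-th term of the upper central series. -/
abbrev Zc (S : Type*) [Group S] (i : ℕ) : Subgroup S := Subgroup.upperCentralSeries S i

/-- `Q₁ = C_S(Z₃(S)/Z₁(S))`: the preimage in `S` of the centralizer in `S / Z₁(S)` of the image
of `Z₃(S)`. -/
def Q1 (S : Type*) [Group S] : Subgroup S :=
  (Subgroup.centralizer ((Zc S 3).map (QuotientGroup.mk' (Zc S 1)) : Set (S ⧸ Zc S 1))).comap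
    (QuotientGroup.mk' (Zc S 1))

/-- `Q₂ = C_S(Z₂(S))`. -/
def Q2 (S : Type*) [Group S] : Subgroup S := Subgroup.centralizer (Zc S 2 : Set S)

end GroupTheory

/-!
A Sylow `p`-subgroup of `G₂(K)` is isomorphic to the explicit group `UnipG2 K`, in which a cubic
form `v₀, v₁, v₂, v₃`, a translation parameter `t` and a central coordinate `z` multiply by
polynomial formulas. This group acts faithfully on the split octonions (`UnipG2.toG2`). A
`p`-group in characteristic `p` has non-zero fixed vectors, and the two simple root elements alone
leave no choice for these: any `p`-subgroup of `G₂(K)` containing the image of `UnipG2 K` acts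
unitriangularly with respect to one fixed flag (`unitriangular_of_isPGroup`), and comparing the
images of two root vectors shows that it is that image (`exists_mulEquiv_unipG2`). In coordinates,
`Q₁` is given by `t = 0`, `Q₂` by `v₀ = 0`, and the upper central series by the vanishing of an
initial segment of the coordinates.

The engine of the classification is `IsRadicalIn.mem_of_chain`: automorphisms which stabilize a
chain of characteristic subgroups of `E` form a normal `p`-subgroup of `Aut(E)`, so if `E` is
centric and radical, any element of `N_S(E)` stabilizing such a chain already lies in `E`.
Whenever enough subgroups defined by commutator or power conditions are recognized as terms of the
upper central series of `S`, this forces `E` to grow. There are three cases.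

* If `E ≤ Q₁`, commutators are given by the invariant symplectic form on cubic forms. A
  non-abelian `E` is `Q₁` (`eq_Q1_of_not_abelian`); an abelian one is the preimage of a Lagrangian
  subspace (`card_of_abelian`), and only for `Z₃(S)` is it normalized by elements outside `Q₁`
  (`normalizer_of_abelian`).
* If `E ≤ Q₂` but `E ≰ Q₁`, then `E` contains `Z₂(S) = Z(Q₂)`. The image of `E` in `Q₂ / Z₃(S)`
  either is not contained in a line, and `E = Q₂`, or is contained in one, and `E` is conjugate to
  the group `v₀ = v₁ = 0` or, when abelian, to `v₀ = v₁ = v₂ = 0`.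
* Otherwise `E` contains a regular element, one with `t` and `v₀` non-zero. All of these are
  conjugate under automorphisms of `S`, so one may take the element `x` with `t = v₀ = 1` and
  other coordinates zero. If a regular element is central in `E`, then `E = C_S(x)` has order
  `q ^ 2` (`regular_central`); if one is central modulo `Z(S)`, then `E` is the centralizer of `x`
  modulo `Z(S)`, a group of order `q ^ 3` which embeds in `SL₃(K)` (`regular_second_center`). If
  neither happens, all terms of the upper central series of `S` are characteristic in `E` and
  `E = S` (`eq_top_of_regular`). In characteristic `5` the regular elements have order `25`
  (`pow_five_eq_one_iff`), so the solutions of `y ^ 5 = 1` in `E` form a characteristic subgroup,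
  which excludes the first two possibilities.
-/

open scoped commutatorElement

/-! ### Radical subgroups and stabilizers of characteristic chains -/

section Radical

variable {S : Type*} [Group S] {p : ℕ}

/-- `D ∩ E` is invariant under every automorphism of `E`. The subgroup `D` need not lie in `E`. -/
def IsCharIn (E D : Subgroup S) : Prop :=
  ∀ (φ : MulAut E) (y : E), (y : S) ∈ D → (φ y : S) ∈ D

theorem IsCharIn.bot (E : Subgroup S) : IsCharIn E ⊥ := by
  intro φ y hy
  have : y = 1 := by simpa using hy
  simp [this]

theorem IsCharIn.top (E : Subgroup S) : IsCharIn E ⊤ := fun _ _ _ => Subgroup.mem_top _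

/-- A relative centralizer `{y ∈ E : [y, E ∩ A] ≤ B}` of characteristic subgroups is
characteristic; this covers the terms of the upper central series of `E`. -/
theorem IsCharIn.of_commutator {E A B D : Subgroup S} (hA : IsCharIn E A) (hB : IsCharIn E B)
    (h : ∀ y ∈ E, y ∈ D ↔ ∀ u ∈ E, u ∈ A → ⁅y, u⁆ ∈ B) : IsCharIn E D := by
  intro φ y hy
  rw [h _ (φ y).2]
  intro u hu huA
  have h1 := (h _ y.2).1 hy (φ⁻¹ ⟨u, hu⟩ : E) (φ⁻¹ ⟨u, hu⟩ : E).2 (hA φ⁻¹ ⟨u, hu⟩ huA)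
  have h2 := hB φ ⁅y, φ⁻¹ ⟨u, hu⟩⁆ h1
  rw [map_commutatorElement, MulAut.apply_inv_self] at h2
  exact h2

theorem IsCharIn.of_pow {E D : Subgroup S} (n : ℕ) (h : ∀ y ∈ E, y ∈ D ↔ y ^ n = 1) :
    IsCharIn E D := by
  intro φ y hy
  rw [h _ (φ y).2]
  have h1 : y ^ n = 1 := Subtype.ext ((h _ y.2).1 hy)
  have h2 : (φ y) ^ n = 1 := by rw [← map_pow, h1, map_one]
  exact congrArg Subtype.val h2

theorem IsCharIn.of_eq_commutators {E D : Subgroup S}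
    (h : ∀ y ∈ E, y ∈ D ↔ ∃ a ∈ E, ∃ b ∈ E, y = ⁅a, b⁆) : IsCharIn E D := by
  intro φ y hy
  obtain ⟨a, ha, b, hb, hab⟩ := (h _ y.2).1 hy
  rw [h _ (φ y).2]
  refine ⟨φ ⟨a, ha⟩, (φ _).2, φ ⟨b, hb⟩, (φ _).2, ?_⟩
  have : y = ⁅(⟨a, ha⟩ : E), (⟨b, hb⟩ : E)⁆ := Subtype.ext hab
  rw [this, map_commutatorElement]
  rfl

/-- The automorphisms of `E` which act trivially on the factors of the chain `E ∩ D i`, `i ≤ k`,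
of characteristic subgroups. -/
def chainStabilizer (E : Subgroup S) (D : ℕ → Subgroup S) (k : ℕ) (hD : ∀ i, IsCharIn E (D i)) :
    Subgroup (MulAut E) where
  carrier := {φ | ∀ i < k, ∀ y : E, (y : S) ∈ D (i + 1) → ((φ y * y⁻¹ : E) : S) ∈ D i}
  one_mem' := fun i _ y _ => by simp
  mul_mem' := fun {φ ψ} hφ hψ i hi y hy => by
    have h1 := hD i φ _ (hψ i hi y hy)
    have h2 := mul_mem h1 (hφ i hi y hy)
    rw [map_mul, map_inv] at h2
    simpa [mul_assoc] using h2
  inv_mem' := fun {φ} hφ i hi y hy => by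
    have h1 := hD i φ⁻¹ (φ y * y⁻¹)⁻¹ (by simpa using inv_mem (hφ i hi y hy))
    rw [show (φ y * y⁻¹)⁻¹ = y * (φ y)⁻¹ by group, map_mul, map_inv, MulAut.inv_apply_self] at h1
    exact h1

theorem chainStabilizer_normal (E : Subgroup S) (D : ℕ → Subgroup S) (k : ℕ)
    (hD : ∀ i, IsCharIn E (D i)) : (chainStabilizer E D k hD).Normal := by
  refine ⟨fun φ hφ ψ i hi y hy => ?_⟩
  have h1 := hφ i hi (ψ⁻¹ y) (hD _ ψ⁻¹ y hy)
  have h2 := hD i ψ _ h1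
  rw [map_mul, map_inv, MulAut.apply_inv_self] at h2
  exact h2

/-- The stabilizer of a chain in a finite `p`-group is a `p`-group: if `ψ` fixes `E ∩ D i`
pointwise and `ψ y = c y` with `c ∈ D i`, then `ψ ^ m` maps `y` to `c ^ m y`. -/
theorem chainStabilizer_isPGroup [Finite S] (hS : IsPGroup p S) [Fact p.Prime] (E : Subgroup S)
    (D : ℕ → Subgroup S) (k : ℕ) (hD : ∀ i, IsCharIn E (D i)) (h0 : D 0 = ⊥) (hk : E ≤ D k) :
    IsPGroup p (chainStabilizer E D k hD) := by
  obtain ⟨M, hM⟩ := IsPGroup.iff_card.1 hS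
  have hpow : ∀ c : E, c ^ p ^ M = 1 := fun c => by
    apply Subtype.ext
    rw [Subgroup.coe_pow, ← hM]
    exact pow_card_eq_one'
  have key : ∀ φ : MulAut E, φ ∈ chainStabilizer E D k hD → ∀ i ≤ k,
      ∃ N : ℕ, ∀ y : E, (y : S) ∈ D i → (φ ^ p ^ N) y = y := by
    intro φ hφ i
    induction i with
    | zero =>
      intro _
      refine ⟨0, fun y hy => ?_⟩
      rw [h0] at hy
      have : y = 1 := by simpa using hy
      rw [this, map_one]
    | succ i ih =>
      intro hi
      obtain ⟨N, hN⟩ := ih (by omega)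
      refine ⟨N + M, fun y hy => ?_⟩
      set ψ := φ ^ p ^ N with hψ
      have hc : ((ψ y * y⁻¹ : E) : S) ∈ D i :=
        (Subgroup.pow_mem _ hφ (p ^ N)) i (by omega) y hy
      obtain ⟨c, hcy⟩ : ∃ c : E, c = ψ y * y⁻¹ := ⟨_, rfl⟩
      have hψc : ψ c = c := hN c (hcy ▸ hc)
      have hψy : ψ y = c * y := by rw [hcy]; simp
      have hm : ∀ m : ℕ, (ψ ^ m) y = c ^ m * y := by
        intro m
        induction m with
        | zero => simp
        | succ m ihm =>
          rw [pow_succ', MulAut.mul_apply, ihm, map_mul, map_pow, hψc, hψy, pow_succ, mul_assoc]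
      rw [pow_add, pow_mul, hm, hpow, one_mul]
  rintro ⟨φ, hφ⟩
  obtain ⟨N, hN⟩ := key φ hφ k le_rfl
  refine ⟨N, Subtype.ext ?_⟩
  ext y
  simpa using congrArg Subtype.val (hN y (hk y.2))

/-- An element of `N_S(E)` which stabilizes a chain of characteristic subgroups of the centric
radical subgroup `E` lies in `E`. -/
theorem IsRadicalIn.mem_of_chain [Finite S] [Fact p.Prime] (hS : IsPGroup p S) {E : Subgroup S}
    (hc : IsCentricIn E) (hr : IsRadicalIn p E) (D : ℕ → Subgroup S) (k : ℕ)
    (hD : ∀ i, IsCharIn E (D i)) (h0 : D 0 = ⊥) (hk : E ≤ D k) {x : S}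
    (hx : x ∈ Subgroup.normalizer (E : Set S))
    (hs : ∀ i < k, ∀ y ∈ E, y ∈ D (i + 1) → ⁅x, y⁆ ∈ D i) : x ∈ E := by
  set φ : MulAut E := E.normalizerMonoidHom ⟨x, hx⟩ with hφ
  have hφy : ∀ y : E, ((φ y : E) : S) = x * y * x⁻¹ := fun y => rfl
  have hA : φ ∈ chainStabilizer E D k hD := fun i hi y hy => by
    have := hs i hi y y.2 hy
    rw [commutatorElement_def] at this
    simpa [hφy] using this
  have hN := (chainStabilizer_normal E D k hD).map (QuotientGroup.mk' (Inn E))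
    (QuotientGroup.mk'_surjective _)
  have hP := (chainStabilizer_isPGroup hS E D k hD h0 hk).map (QuotientGroup.mk' (Inn E))
  have h1 : QuotientGroup.mk' (Inn E) φ ∈ Op p (Out E) ⊓ OutIn E :=
    ⟨(le_sSup (show _ ∈ {N : Subgroup (Out E) | N.Normal ∧ IsPGroup p N} from ⟨hN, hP⟩) :
        _ ≤ Op p (Out E)) (Subgroup.mem_map_of_mem _ hA),
      Subgroup.mem_map_of_mem _ ⟨⟨x, hx⟩, rfl⟩⟩
  rw [show Op p (Out E) ⊓ OutIn E = ⊥ from hr, Subgroup.mem_bot] at h1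
  obtain ⟨e, he⟩ := (QuotientGroup.eq_one_iff φ).1 h1
  have h2 : (e : S)⁻¹ * x ∈ Subgroup.centralizer (E : Set S) := by
    rw [Subgroup.mem_centralizer_iff]
    intro y hy
    have h3 := congrArg (fun ψ : MulAut E => ((ψ ⟨y, hy⟩ : E) : S)) he
    simp only [MulAut.conj_apply, hφy, Subgroup.coe_mul, Subgroup.coe_inv] at h3
    calc y * ((e : S)⁻¹ * x) = (e : S)⁻¹ * (e * y * (e : S)⁻¹) * x := by group
      _ = (e : S)⁻¹ * x * y := by rw [h3]; group
  rw [show Subgroup.centralizer (E : Set S) = centerIn E from hc] at h2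
  obtain ⟨d, -, hd⟩ := h2
  have : x = e * d := by
    rw [show (d : S) = (e : S)⁻¹ * x from hd]; group
  rw [this]
  exact mul_mem e.2 d.2

theorem IsCentricIn.mem {E : Subgroup S} (hc : IsCentricIn E) {x : S}
    (hx : ∀ y ∈ E, y * x = x * y) : x ∈ E := by
  have h2 : x ∈ Subgroup.centralizer (E : Set S) := Subgroup.mem_centralizer_iff.2 hx
  rw [show Subgroup.centralizer (E : Set S) = centerIn E from hc] at h2
  obtain ⟨d, -, rfl⟩ := h2
  exact d.2

theorem mem_centerIn {E : Subgroup S} {x : S} :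
    x ∈ centerIn E ↔ x ∈ E ∧ ∀ y ∈ E, y * x = x * y := by
  constructor
  · rintro ⟨d, hd, rfl⟩
    exact ⟨d.2, fun y hy => congrArg Subtype.val (Subgroup.mem_center_iff.1 hd ⟨y, hy⟩)⟩
  · rintro ⟨hx, h⟩
    exact ⟨⟨x, hx⟩, Subgroup.mem_center_iff.2 fun y => Subtype.ext (h y y.2), rfl⟩

/-- The case of a chain `1 ≤ D ≤ E`. -/
theorem IsRadicalIn.mem_of_chain_one [Finite S] [Fact p.Prime] (hS : IsPGroup p S)
    {E : Subgroup S} (hc : IsCentricIn E) (hr : IsRadicalIn p E) {D : Subgroup S}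
    (hD : IsCharIn E D) {x : S} (hx : x ∈ Subgroup.normalizer (E : Set S))
    (h1 : ∀ y ∈ E, ⁅x, y⁆ ∈ D) (h2 : ∀ y ∈ E, y ∈ D → ⁅x, y⁆ = 1) : x ∈ E := by
  refine hr.mem_of_chain hS hc (fun i => if i = 0 then ⊥ else if i = 1 then D else ⊤) 2
    (fun i => ?_) (by simp) (by simp) hx ?_
  · split_ifs
    exacts [IsCharIn.bot E, hD, IsCharIn.top E]
  · intro i hi
    interval_cases i
    · simpa using h2
    · simpa using fun y hy => h1 y hy

/-- The case of a chain `1 ≤ D₁ ≤ D₂ ≤ E`. -/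
theorem IsRadicalIn.mem_of_chain_two [Finite S] [Fact p.Prime] (hS : IsPGroup p S)
    {E : Subgroup S} (hc : IsCentricIn E) (hr : IsRadicalIn p E) {D₁ D₂ : Subgroup S}
    (hD₁ : IsCharIn E D₁) (hD₂ : IsCharIn E D₂) {x : S}
    (hx : x ∈ Subgroup.normalizer (E : Set S)) (h1 : ∀ y ∈ E, ⁅x, y⁆ ∈ D₂)
    (h2 : ∀ y ∈ E, y ∈ D₂ → ⁅x, y⁆ ∈ D₁) (h3 : ∀ y ∈ E, y ∈ D₁ → ⁅x, y⁆ = 1) : x ∈ E := by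
  refine hr.mem_of_chain hS hc
    (fun i => if i = 0 then ⊥ else if i = 1 then D₁ else if i = 2 then D₂ else ⊤) 3
    (fun i => ?_) (by simp) (by simp) hx ?_
  · split_ifs
    exacts [IsCharIn.bot E, hD₁, hD₂, IsCharIn.top E]
  · intro i hi
    interval_cases i
    · simpa using h3
    · simpa using h2
    · simpa using fun y hy => h1 y hy

end Radical

/-! ### The Frattini subgroup of a finite `p`-group -/

section Frattini

variable {G : Type*} [Group G] [Finite G] {p : ℕ} [Fact p.Prime]

theorem commutatorElement_mem_frattini (hG : IsPGroup p G) (a b : G) : ⁅a, b⁆ ∈ frattini G := by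
  have : Group.IsNilpotent G := hG.isNilpotent
  rw [frattini, Order.radical]
  simp only [Subgroup.mem_iInf]
  intro M hM
  have hN : M.Normal :=
    Subgroup.NormalizerCondition.normal_of_coatom M Group.normalizerCondition_of_isNilpotent hM
  by_cases ha : a ∈ M
  · rw [commutatorElement_def, mul_assoc, mul_assoc, ← mul_assoc b]
    exact mul_mem ha (hN.conj_mem _ (inv_mem ha) b)
  · have htop : M ⊔ Subgroup.zpowers a = ⊤ := hM.2 _ (lt_of_le_of_ne le_sup_left fun h =>
      ha (h ▸ Subgroup.mem_sup_right (Subgroup.mem_zpowers a)))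
    obtain ⟨m, hm, c, ⟨k, rfl⟩, rfl⟩ := Subgroup.mem_sup_of_normal_left.1
      (show b ∈ M ⊔ Subgroup.zpowers a from htop ▸ Subgroup.mem_top b)
    have : ⁅a, m * a ^ k⁆ = a * m * a⁻¹ * m⁻¹ := by
      rw [commutatorElement_def]; group
    simp only [this]
    exact mul_mem (hN.conj_mem _ hm a) (inv_mem hm)

/-- An element outside a normal subgroup with elementary abelian quotient is avoided by a maximal
subgroup: a subgroup maximal among those which contain `N` and avoid `y` is a maximal subgroup. -/
theorem frattini_le_of_forall (N : Subgroup G)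
    (hc : ∀ a b : G, ⁅a, b⁆ ∈ N) (hp : ∀ a : G, a ^ p ∈ N) : frattini G ≤ N := by
  intro y hy
  by_contra hyN
  obtain ⟨H, hH⟩ := (Set.toFinite {H : Subgroup G | N ≤ H ∧ y ∉ H}).exists_maximal
    ⟨N, le_rfl, hyN⟩
  have hHn : H.Normal := ⟨fun n hn g => by
    have := mul_mem (hH.prop.1 (hc g n)) hn
    rwa [commutatorElement_def, inv_mul_cancel_right] at this⟩
  have hmax : ∀ L : Subgroup G, H < L → y ∈ L := fun L hL => by
    by_contra hyL
    exact hL.not_ge (hH.le_of_ge ⟨hH.prop.1.trans hL.le, hyL⟩ hL.le)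
  refine hH.prop.2 (frattini_le_coatom (K := H) ⟨fun h => hH.prop.2 (h ▸ Subgroup.mem_top y), ?_⟩
    hy)
  intro L hL
  rw [eq_top_iff]
  intro a _
  by_cases ha : a ∈ H
  · exact hL.le ha
  have hya := hmax (H ⊔ Subgroup.zpowers a) (lt_of_le_of_ne le_sup_left fun h =>
      ha (h ▸ Subgroup.mem_sup_right (Subgroup.mem_zpowers a)))
  obtain ⟨h, hh, c, ⟨k, rfl⟩, rfl⟩ := Subgroup.mem_sup_of_normal_left.1 hya
  have hyL := hmax L hL
  have hak : a ^ k ∈ L := by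
    have := mul_mem (inv_mem (hL.le hh)) hyL
    simpa using this
  have hap : a ^ p ∈ L := hL.le (hH.prop.1 (hp a))
  have hk : IsCoprime (p : ℤ) k := by
    rw [(Nat.prime_iff_prime_int.1 (Fact.out : p.Prime)).irreducible.coprime_iff_not_dvd]
    rintro ⟨j, rfl⟩
    refine hH.prop.2 (mul_mem hh (hH.prop.1 ?_))
    simp only [zpow_mul, zpow_natCast]
    exact N.zpow_mem (hp a) j
  obtain ⟨u, v, huv⟩ := hk
  have : a = (a ^ p) ^ u * (a ^ k) ^ v := by
    rw [← zpow_natCast, ← zpow_mul, ← zpow_mul, ← zpow_add, mul_comm (p : ℤ), mul_comm k, huv,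
      zpow_one]
  rw [this]
  exact mul_mem (L.zpow_mem hap u) (L.zpow_mem hak v)

/-- The Frattini subgroup of a `p`-subgroup `E` is the subgroup of commutators, if these form a
subgroup which contains all `p`-th powers. -/
theorem frattiniIn_eq (hG : IsPGroup p G) (E N : Subgroup G)
    (hNE : ∀ y ∈ N, ∃ a ∈ E, ∃ b ∈ E, y = ⁅a, b⁆)
    (hc : ∀ a ∈ E, ∀ b ∈ E, ⁅a, b⁆ ∈ N) (hp : ∀ a ∈ E, a ^ p ∈ N) : frattiniIn E = N := by
  apply le_antisymm
  · rintro _ ⟨y, hy, rfl⟩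
    exact frattini_le_of_forall (p := p) (N.subgroupOf E) (fun a b => hc a a.2 b b.2)
      (fun a => hp a a.2) hy
  · intro y hy
    obtain ⟨a, ha, b, hb, rfl⟩ := hNE y hy
    exact ⟨⁅(⟨a, ha⟩ : E), ⟨b, hb⟩⁆,
      commutatorElement_mem_frattini (p := p) (hG.to_subgroup E) _ _, rfl⟩

end Frattini

/-! ### A polynomial model of the unipotent radical of a Borel subgroup of `G₂` -/

section Model

/-- A model of a maximal unipotent subgroup of `G₂(K)`, as the semidirect product of the additive
group of `K` (coordinate `t`) with the Heisenberg group on the space of binary cubic forms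
(coordinates `v₀, v₁, v₂, v₃`) with centre `K` (coordinate `z`). The coordinates belong to the
positive roots `α, β, α + β, 2α + β, 3α + β, 3α + 2β` with `α` the short simple root. -/
@[ext]
structure UnipG2 (K : Type*) where
  /-- coordinate of the short simple root `α` -/
  t : K
  /-- coordinate of the long simple root `β` -/
  v₀ : K
  /-- coordinate of `α + β` -/
  v₁ : K
  /-- coordinate of `2α + β` -/
  v₂ : K
  /-- coordinate of `3α + β` -/
  v₃ : K
  /-- coordinate of the highest root `3α + 2β` -/
  z : K

namespace UnipG2

variable {K : Type*} [Field K]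

/-- In `g * h` the form `v` of `g` is first translated by the coordinate `t` of `h`; the
`z`-coordinates are then added with the invariant symplectic form
`v₀ w₃ - 3 v₁ w₂ + 3 v₂ w₁ - v₃ w₀` on cubic forms as cocycle. -/
instance : Mul (UnipG2 K) where
  mul g h :=
    { t := g.t + h.t
      v₀ := g.v₀ + h.v₀
      v₁ := g.v₁ + h.t * g.v₀ + h.v₁
      v₂ := g.v₂ + 2 * h.t * g.v₁ + h.t ^ 2 * g.v₀ + h.v₂
      v₃ := g.v₃ + 3 * h.t * g.v₂ + 3 * h.t ^ 2 * g.v₁ + h.t ^ 3 * g.v₀ + h.v₃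
      z := g.z + h.z + (g.v₀ * h.v₃ - 3 * (g.v₁ + h.t * g.v₀) * h.v₂
        + 3 * (g.v₂ + 2 * h.t * g.v₁ + h.t ^ 2 * g.v₀) * h.v₁
        - (g.v₃ + 3 * h.t * g.v₂ + 3 * h.t ^ 2 * g.v₁ + h.t ^ 3 * g.v₀) * h.v₀) }

instance : One (UnipG2 K) where
  one := ⟨0, 0, 0, 0, 0, 0⟩

instance : Inv (UnipG2 K) where
  inv g := ⟨-g.t, -g.v₀, -(g.v₁ - g.t * g.v₀), -(g.v₂ - 2 * g.t * g.v₁ + g.t ^ 2 * g.v₀),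
    -(g.v₃ - 3 * g.t * g.v₂ + 3 * g.t ^ 2 * g.v₁ - g.t ^ 3 * g.v₀), -g.z⟩

@[simp] theorem mul_t (g h : UnipG2 K) : (g * h).t = g.t + h.t := rfl
@[simp] theorem mul_v₀ (g h : UnipG2 K) : (g * h).v₀ = g.v₀ + h.v₀ := rfl
@[simp] theorem mul_v₁ (g h : UnipG2 K) : (g * h).v₁ = g.v₁ + h.t * g.v₀ + h.v₁ := rfl
@[simp] theorem mul_v₂ (g h : UnipG2 K) :
    (g * h).v₂ = g.v₂ + 2 * h.t * g.v₁ + h.t ^ 2 * g.v₀ + h.v₂ := rfl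
@[simp] theorem mul_v₃ (g h : UnipG2 K) :
    (g * h).v₃ = g.v₃ + 3 * h.t * g.v₂ + 3 * h.t ^ 2 * g.v₁ + h.t ^ 3 * g.v₀ + h.v₃ := rfl
@[simp] theorem mul_z (g h : UnipG2 K) :
    (g * h).z = g.z + h.z + (g.v₀ * h.v₃ - 3 * (g.v₁ + h.t * g.v₀) * h.v₂
        + 3 * (g.v₂ + 2 * h.t * g.v₁ + h.t ^ 2 * g.v₀) * h.v₁
        - (g.v₃ + 3 * h.t * g.v₂ + 3 * h.t ^ 2 * g.v₁ + h.t ^ 3 * g.v₀) * h.v₀) := rfl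
@[simp] theorem one_t : (1 : UnipG2 K).t = 0 := rfl
@[simp] theorem one_v₀ : (1 : UnipG2 K).v₀ = 0 := rfl
@[simp] theorem one_v₁ : (1 : UnipG2 K).v₁ = 0 := rfl
@[simp] theorem one_v₂ : (1 : UnipG2 K).v₂ = 0 := rfl
@[simp] theorem one_v₃ : (1 : UnipG2 K).v₃ = 0 := rfl
@[simp] theorem one_z : (1 : UnipG2 K).z = 0 := rfl
@[simp] theorem inv_t (g : UnipG2 K) : g⁻¹.t = -g.t := rfl
@[simp] theorem inv_v₀ (g : UnipG2 K) : g⁻¹.v₀ = -g.v₀ := rfl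
@[simp] theorem inv_v₁ (g : UnipG2 K) : g⁻¹.v₁ = -(g.v₁ - g.t * g.v₀) := rfl
@[simp] theorem inv_v₂ (g : UnipG2 K) :
    g⁻¹.v₂ = -(g.v₂ - 2 * g.t * g.v₁ + g.t ^ 2 * g.v₀) := rfl
@[simp] theorem inv_v₃ (g : UnipG2 K) :
    g⁻¹.v₃ = -(g.v₃ - 3 * g.t * g.v₂ + 3 * g.t ^ 2 * g.v₁ - g.t ^ 3 * g.v₀) := rfl
@[simp] theorem inv_z (g : UnipG2 K) : g⁻¹.z = -g.z := rfl

instance : Group (UnipG2 K) :=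
  Group.ofLeftAxioms
    (fun a b c => by ext <;> simp <;> ring)
    (fun a => by ext <;> simp)
    (fun a => by ext <;> simp <;> ring)

/-- The coordinates, as a bijection with a product of copies of `K`. -/
def equivProd : UnipG2 K ≃ K × K × K × K × K × K where
  toFun g := (g.t, g.v₀, g.v₁, g.v₂, g.v₃, g.z)
  invFun a := ⟨a.1, a.2.1, a.2.2.1, a.2.2.2.1, a.2.2.2.2.1, a.2.2.2.2.2⟩
  left_inv _ := rfl
  right_inv _ := rfl

instance [Finite K] : Finite (UnipG2 K) := Finite.of_equiv _ equivProd.symm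

omit [Field K] in
theorem card : Nat.card (UnipG2 K) = Nat.card K ^ 6 := by
  rw [Nat.card_congr equivProd]
  simp only [Nat.card_prod]
  ring

/-- The torus of `G₂(K)` acts on its maximal unipotent subgroup. -/
def torus (a b : K) (ha : a ≠ 0) (hb : b ≠ 0) : UnipG2 K ≃* UnipG2 K where
  toFun g := ⟨a * g.t, b * g.v₀, a * b * g.v₁, a ^ 2 * b * g.v₂, a ^ 3 * b * g.v₃,
    a ^ 3 * b ^ 2 * g.z⟩
  invFun g := ⟨a⁻¹ * g.t, b⁻¹ * g.v₀, (a * b)⁻¹ * g.v₁, (a ^ 2 * b)⁻¹ * g.v₂,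
    (a ^ 3 * b)⁻¹ * g.v₃, (a ^ 3 * b ^ 2)⁻¹ * g.z⟩
  left_inv g := by ext <;> simp <;> field_simp
  right_inv g := by ext <;> simp <;> field_simp
  map_mul' g h := by ext <;> simp <;> ring

/-- In characteristic `5` the fifth power map is given by the `z`-coordinate `4 t ^ 3 v₀ ^ 2`,
so exactly the elements with `t` and `v₀` non-zero have order `25`. -/
theorem pow_five (h5 : (5 : K) = 0) (g : UnipG2 K) :
    g ^ 5 = ⟨0, 0, 0, 0, 0, 4 * g.t ^ 3 * g.v₀ ^ 2⟩ := by
  simp only [pow_succ, pow_zero, one_mul]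
  ext
  · simp only [mul_t]
    linear_combination g.t * h5
  · simp only [mul_v₀]
    linear_combination g.v₀ * h5
  · simp only [mul_v₁, mul_v₀]
    linear_combination (g.v₁ + 2 * g.t * g.v₀) * h5
  · simp only [mul_v₂, mul_v₁, mul_v₀]
    linear_combination (g.v₂ + 4 * g.t * g.v₁ + 6 * g.t ^ 2 * g.v₀) * h5
  · simp only [mul_v₃, mul_v₂, mul_v₁, mul_v₀]
    linear_combination (g.v₃ + 6 * g.t * g.v₂ + 18 * g.t ^ 2 * g.v₁ + 20 * g.t ^ 3 * g.v₀) * h5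
  · simp only [mul_z, mul_v₃, mul_v₂, mul_v₁, mul_v₀]
    linear_combination (g.z - 24 * g.t * g.v₀ * g.v₂ + 24 * g.t * g.v₁ ^ 2
      - 30 * g.t ^ 3 * g.v₀ ^ 2) * h5

/-- The coordinates of a power are polynomials in the exponent, without constant term; the
denominators of their coefficients divide `60`. -/
theorem pow_formula (g : UnipG2 K) (n : ℕ) :
    (g ^ n).t = n * g.t ∧ (g ^ n).v₀ = n * g.v₀ ∧
    2 * (g ^ n).v₁ = n * (2 * g.v₁ + (n - 1) * g.t * g.v₀) ∧
    6 * (g ^ n).v₂ = n * (6 * g.v₂ + 6 * (n - 1) * g.t * g.v₁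
      + (n - 1) * (2 * n - 1) * g.t ^ 2 * g.v₀) ∧
    4 * (g ^ n).v₃ = n * (4 * g.v₃ + 6 * (n - 1) * g.t * g.v₂
      + 2 * (n - 1) * (2 * n - 1) * g.t ^ 2 * g.v₁ + n * (n - 1) ^ 2 * g.t ^ 3 * g.v₀) ∧
    60 * (g ^ n).z = n * (60 * g.z + 60 * (n ^ 2 - 1) * g.t * (g.v₁ ^ 2 - g.v₀ * g.v₂)
      - (n - 1) * (30 + 70 * (n - 2) + 30 * (n - 2) * (n - 3) + 3 * (n - 2) * (n - 3) * (n - 4))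
        * g.t ^ 3 * g.v₀ ^ 2) := by
  induction n with
  | zero => simp
  | succ n ih =>
    obtain ⟨ht, h0, h1, h2, h3, hz⟩ := ih
    rw [pow_succ]
    simp only [mul_t, mul_v₀, mul_v₁, mul_v₂, mul_v₃, mul_z]
    push_cast
    refine ⟨?_, ?_, ?_, ?_, ?_, ?_⟩
    · linear_combination ht
    · linear_combination h0
    · linear_combination h1 + 2 * g.t * h0
    · linear_combination h2 + 6 * g.t * h1 + 6 * g.t ^ 2 * h0
    · linear_combination h3 + 2 * g.t * h2 + 6 * g.t ^ 2 * h1 + 4 * g.t ^ 3 * h0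
    · linear_combination hz + (60 * g.v₃ - 60 * g.t ^ 3 * g.v₀) * h0 - 90 * g.v₂ * h1
        - 180 * g.t * g.v₂ * h0 + 30 * g.v₁ * h2 + 180 * g.t * g.v₁ * h1 + 180 * g.t ^ 2 * g.v₁ * h0
        - 15 * g.v₀ * h3 - 30 * g.t * g.v₀ * h2 - 90 * g.t ^ 2 * g.v₀ * h1

theorem pow_eq_one_of_natCast {n : ℕ} (hn : (n : K) = 0) (h60 : (60 : K) ≠ 0) (g : UnipG2 K) :
    g ^ n = 1 := by
  have h2 : (2 : K) ≠ 0 := fun h => h60 (by linear_combination 30 * h)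
  have h4 : (4 : K) ≠ 0 := fun h => h60 (by linear_combination 15 * h)
  have h6 : (6 : K) ≠ 0 := fun h => h60 (by linear_combination 10 * h)
  obtain ⟨ht, hv0, hv1, hv2, hv3, hz⟩ := pow_formula g n
  simp only [hn, zero_mul, mul_eq_zero, h2, h4, h6, h60, false_or] at ht hv0 hv1 hv2 hv3 hz
  ext <;> assumption

end UnipG2

end Model

/-! ### The unipotent subgroup of the automorphism group of the split octonions -/

section Embedding

variable {K : Type*} [Field K]

omit [Field K] in
theorem ZornMatrix.ext_coord {x y : ZornMatrix K} (ha : x.1 = y.1)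
    (hu0 : x.2.1 0 = y.2.1 0) (hu1 : x.2.1 1 = y.2.1 1) (hu2 : x.2.1 2 = y.2.1 2)
    (hv0 : x.2.2.1 0 = y.2.2.1 0) (hv1 : x.2.2.1 1 = y.2.2.1 1) (hv2 : x.2.2.1 2 = y.2.2.1 2)
    (hb : x.2.2.2 = y.2.2.2) : x = y := by
  refine Prod.ext ha (Prod.ext ?_ (Prod.ext ?_ hb))
  · funext i; fin_cases i <;> assumption
  · funext i; fin_cases i <;> assumption

theorem ZornMatrix.mul_def (x y : ZornMatrix K) : ZornMatrix.mul x y =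
    (x.1 * y.1 + x.2.1 ⬝ᵥ y.2.2.1,
     x.1 • y.2.1 + y.2.2.2 • x.2.1 + crossProduct x.2.2.1 y.2.2.1,
     y.1 • x.2.2.1 + x.2.2.2 • y.2.2.1 - crossProduct x.2.1 y.2.1,
     x.2.2.2 * y.2.2.2 + x.2.2.1 ⬝ᵥ y.2.1) := rfl

section Coordinates

variable (x y : ZornMatrix K)

theorem ZornMatrix.mul_a : (ZornMatrix.mul x y).1 = x.1 * y.1
    + (x.2.1 0 * y.2.2.1 0 + x.2.1 1 * y.2.2.1 1 + x.2.1 2 * y.2.2.1 2) := by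
  simp [ZornMatrix.mul_def, dotProduct, Fin.sum_univ_three]

theorem ZornMatrix.mul_b : (ZornMatrix.mul x y).2.2.2 = x.2.2.2 * y.2.2.2
    + (x.2.2.1 0 * y.2.1 0 + x.2.2.1 1 * y.2.1 1 + x.2.2.1 2 * y.2.1 2) := by
  simp [ZornMatrix.mul_def, dotProduct, Fin.sum_univ_three]

theorem ZornMatrix.mul_u₀ : (ZornMatrix.mul x y).2.1 0 = x.1 * y.2.1 0 + y.2.2.2 * x.2.1 0
    + (x.2.2.1 1 * y.2.2.1 2 - x.2.2.1 2 * y.2.2.1 1) := by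
  simp [ZornMatrix.mul_def, cross_apply]
  rfl

theorem ZornMatrix.mul_u₁ : (ZornMatrix.mul x y).2.1 1 = x.1 * y.2.1 1 + y.2.2.2 * x.2.1 1
    + (x.2.2.1 2 * y.2.2.1 0 - x.2.2.1 0 * y.2.2.1 2) := by
  simp [ZornMatrix.mul_def, cross_apply]
  rfl

theorem ZornMatrix.mul_u₂ : (ZornMatrix.mul x y).2.1 2 = x.1 * y.2.1 2 + y.2.2.2 * x.2.1 2
    + (x.2.2.1 0 * y.2.2.1 1 - x.2.2.1 1 * y.2.2.1 0) := by
  simp [ZornMatrix.mul_def, cross_apply]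
  rfl

theorem ZornMatrix.mul_v₀ : (ZornMatrix.mul x y).2.2.1 0 = y.1 * x.2.2.1 0 + x.2.2.2 * y.2.2.1 0
    - (x.2.1 1 * y.2.1 2 - x.2.1 2 * y.2.1 1) := by
  simp [ZornMatrix.mul_def, cross_apply]
  rfl

theorem ZornMatrix.mul_v₁ : (ZornMatrix.mul x y).2.2.1 1 = y.1 * x.2.2.1 1 + x.2.2.2 * y.2.2.1 1
    - (x.2.1 2 * y.2.1 0 - x.2.1 0 * y.2.1 2) := by
  simp [ZornMatrix.mul_def, cross_apply]
  rfl

theorem ZornMatrix.mul_v₂ : (ZornMatrix.mul x y).2.2.1 2 = y.1 * x.2.2.1 2 + x.2.2.2 * y.2.2.1 2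
    - (x.2.1 0 * y.2.1 1 - x.2.1 1 * y.2.1 0) := by
  simp [ZornMatrix.mul_def, cross_apply]
  rfl

end Coordinates

namespace UnipG2

/-- A substitute for the coordinate `z`, in which the action on the split octonions has integral
coefficients. -/
def zeta (g : UnipG2 K) : K := (g.v₀ * g.v₃ - g.v₁ * g.v₂ - g.z) / 2

@[simp] theorem zeta_one : (1 : UnipG2 K).zeta = 0 := by simp [zeta]

theorem zeta_mul (h2 : (2 : K) ≠ 0) (g h : UnipG2 K) :
    (g * h).zeta = g.zeta + h.zeta + h.t * (g.v₀ * g.v₂ - g.v₁ ^ 2)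
      + (g.v₃ + 3 * h.t * g.v₂ + 3 * h.t ^ 2 * g.v₁ + h.t ^ 3 * g.v₀) * h.v₀
      + (g.v₁ + h.t * g.v₀) * h.v₂
      - 2 * (g.v₂ + 2 * h.t * g.v₁ + h.t ^ 2 * g.v₀) * h.v₁ := by
  simp only [zeta, mul_v₀, mul_v₁, mul_v₂, mul_v₃, mul_z]
  field_simp
  ring

/-- The action of the unipotent group on Zorn matrices: `exp(t D)` times `exp(v, z)`, where `D` and
`(v, z)` are nilpotent derivations of the split octonions. -/
def act (g : UnipG2 K) (w : ZornMatrix K) : ZornMatrix K :=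
  (w.1 - g.t * w.2.1 1 + (g.v₁ - g.v₀ * g.t) * w.2.1 2 + (g.v₂ - g.v₁ * g.t) * w.2.2.1 0,
   ![(g.v₁ * g.t - g.v₂) * (w.1 - w.2.2.2) + w.2.1 0 + (g.v₃ - g.v₂ * g.t) * w.2.1 1
      + (g.zeta - g.v₀ * g.v₂ * g.t + g.v₁ ^ 2 * g.t) * w.2.1 2
      + (g.v₁ * g.v₃ - g.v₂ ^ 2 - g.t * (g.v₀ * g.v₃ - g.v₁ * g.v₂ - g.zeta)) * w.2.2.1 0
      + (g.v₀ * g.t - g.v₁) * w.2.2.1 1 - g.t * w.2.2.1 2,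
     w.2.1 1 + g.v₀ * w.2.1 2 + g.v₁ * w.2.2.1 0,
     w.2.1 2 + g.t * w.2.2.1 0],
   ![w.2.2.1 0,
     g.t * (w.1 - w.2.2.2) - g.t ^ 2 * w.2.1 1
      + (2 * g.v₁ * g.t - g.v₂ - g.v₀ * g.t ^ 2) * w.2.1 2
      + (2 * g.v₂ * g.t - g.v₃ - g.v₁ * g.t ^ 2) * w.2.2.1 0 + w.2.2.1 1,
     -g.v₁ * (w.1 - w.2.2.2) + g.v₂ * w.2.1 1 + (g.v₀ * g.v₂ - g.v₁ ^ 2) * w.2.1 2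
      + (g.v₀ * g.v₃ - g.v₁ * g.v₂ - g.zeta) * w.2.2.1 0 - g.v₀ * w.2.2.1 1 + w.2.2.1 2],
   w.2.2.2 + g.t * w.2.1 1 + (g.v₀ * g.t - g.v₁) * w.2.1 2 + (g.v₁ * g.t - g.v₂) * w.2.2.1 0)

theorem act_a (g : UnipG2 K) (w : ZornMatrix K) : (act g w).1 =
    w.1 - g.t * w.2.1 1 + (g.v₁ - g.v₀ * g.t) * w.2.1 2 + (g.v₂ - g.v₁ * g.t) * w.2.2.1 0 := rfl

theorem act_u₀ (g : UnipG2 K) (w : ZornMatrix K) : (act g w).2.1 0 =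
    (g.v₁ * g.t - g.v₂) * (w.1 - w.2.2.2) + w.2.1 0
      + (g.v₃ - g.v₂ * g.t) * w.2.1 1 + (g.zeta - g.v₀ * g.v₂ * g.t + g.v₁ ^ 2 * g.t) * w.2.1 2
      + (g.v₁ * g.v₃ - g.v₂ ^ 2 - g.t * (g.v₀ * g.v₃ - g.v₁ * g.v₂ - g.zeta)) * w.2.2.1 0
      + (g.v₀ * g.t - g.v₁) * w.2.2.1 1 - g.t * w.2.2.1 2 := rfl

theorem act_u₁ (g : UnipG2 K) (w : ZornMatrix K) : (act g w).2.1 1 =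
    w.2.1 1 + g.v₀ * w.2.1 2 + g.v₁ * w.2.2.1 0 := rfl

theorem act_u₂ (g : UnipG2 K) (w : ZornMatrix K) : (act g w).2.1 2 =
    w.2.1 2 + g.t * w.2.2.1 0 := rfl

theorem act_v₀ (g : UnipG2 K) (w : ZornMatrix K) : (act g w).2.2.1 0 =
    w.2.2.1 0 := rfl

theorem act_v₁ (g : UnipG2 K) (w : ZornMatrix K) : (act g w).2.2.1 1 =
    g.t * (w.1 - w.2.2.2) - g.t ^ 2 * w.2.1 1
      + (2 * g.v₁ * g.t - g.v₂ - g.v₀ * g.t ^ 2) * w.2.1 2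
      + (2 * g.v₂ * g.t - g.v₃ - g.v₁ * g.t ^ 2) * w.2.2.1 0 + w.2.2.1 1 := rfl

theorem act_v₂ (g : UnipG2 K) (w : ZornMatrix K) : (act g w).2.2.1 2 =
    -g.v₁ * (w.1 - w.2.2.2) + g.v₂ * w.2.1 1
      + (g.v₀ * g.v₂ - g.v₁ ^ 2) * w.2.1 2
      + (g.v₀ * g.v₃ - g.v₁ * g.v₂ - g.zeta) * w.2.2.1 0 - g.v₀ * w.2.2.1 1 + w.2.2.1 2 := rfl

theorem act_b (g : UnipG2 K) (w : ZornMatrix K) : (act g w).2.2.2 =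
    w.2.2.2 + g.t * w.2.1 1 + (g.v₀ * g.t - g.v₁) * w.2.1 2
      + (g.v₁ * g.t - g.v₂) * w.2.2.1 0 := rfl

theorem act_one (w : ZornMatrix K) : act 1 w = w := by
  apply ZornMatrix.ext_coord <;> simp [act_a, act_u₀, act_u₁, act_u₂, act_v₀, act_v₁, act_v₂, act_b]

theorem act_mul (h2 : (2 : K) ≠ 0) (g h : UnipG2 K) (w : ZornMatrix K) :
    act (g * h) w = act g (act h w) := by
  apply ZornMatrix.ext_coord <;>
    simp only [act_a, act_u₀, act_u₁, act_u₂, act_v₀, act_v₁, act_v₂, act_b, zeta_mul h2, mul_t,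
      mul_v₀, mul_v₁, mul_v₂, mul_v₃] <;> ring

open ZornMatrix in
theorem act_zornMul (g : UnipG2 K) (x y : ZornMatrix K) :
    act g (ZornMatrix.mul x y) = ZornMatrix.mul (act g x) (act g y) := by
  apply ZornMatrix.ext_coord <;>
    simp only [ZornMatrix.mul_a, ZornMatrix.mul_b, mul_u₀, mul_u₁, mul_u₂, ZornMatrix.mul_v₀,
      ZornMatrix.mul_v₁, ZornMatrix.mul_v₂, act_a, act_u₀, act_u₁, act_u₂, act_v₀, act_v₁, act_v₂,
      act_b] <;>
    ring

/-- The embedding of the unipotent group in `G₂(K)`. -/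
def toG2 (h2 : (2 : K) ≠ 0) : UnipG2 K →* G2 K where
  toFun g := ⟨{ toFun := act g
                map_add' := fun x y => by
                  apply ZornMatrix.ext_coord <;> simp [act] <;> ring
                map_smul' := fun c x => by
                  apply ZornMatrix.ext_coord <;> simp [act] <;> ring
                invFun := act g⁻¹
                left_inv := fun x => by rw [← act_mul h2, inv_mul_cancel, act_one]
                right_inv := fun x => by rw [← act_mul h2, mul_inv_cancel, act_one] },
    act_zornMul g⟩
  map_one' := Subtype.ext (LinearEquiv.ext fun x => act_one x)
  map_mul' g h := Subtype.ext (LinearEquiv.ext fun x => act_mul h2 g h x)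

@[simp] theorem toG2_apply (h2 : (2 : K) ≠ 0) (g : UnipG2 K) (x : ZornMatrix K) :
    (toG2 h2 g : ZornMatrix K ≃ₗ[K] ZornMatrix K) x = act g x := rfl

end UnipG2

end Embedding

/-! ### Sylow subgroups of `G₂(K)` -/

section FixedVectors

variable {K M Γ : Type*} [Field K] [Finite K] [AddCommGroup M] [Module K M]
  [Group Γ] {p : ℕ} [Fact p.Prime]

/-- A `p`-group acting linearly in characteristic `p` on a finite module fixes a non-zero vector in
the quotient by any proper invariant submodule. -/
theorem IsPGroup.exists_fixed_mod [Module.Finite K M] (hp : p ∣ Nat.card K) (hΓ : IsPGroup p Γ)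
    (ρ : Γ →* (M ≃ₗ[K] M)) (F : Submodule K M) (hF : ∀ g, ∀ f ∈ F, ρ g f ∈ F) (hne : F ≠ ⊤) :
    ∃ w ∉ F, ∀ g, ρ g w - w ∈ F := by
  let _ : MulAction Γ (M ⧸ F) :=
    { smul := fun g x => F.mapQ F (ρ g : M →ₗ[K] M) (hF g) x
      one_smul := fun x => by
        obtain ⟨y, rfl⟩ := F.mkQ_surjective x
        change F.mapQ F (ρ 1 : M →ₗ[K] M) (hF 1) _ = _
        simp
      mul_smul := fun g h x => by
        obtain ⟨y, rfl⟩ := F.mkQ_surjective x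
        change F.mapQ F (ρ (g * h) : M →ₗ[K] M) (hF _) _ =
          F.mapQ F (ρ g : M →ₗ[K] M) (hF _) (F.mapQ F (ρ h : M →ₗ[K] M) (hF _) _)
        simp }
  have hsmul : ∀ (g : Γ) (y : M), g • (F.mkQ y) = F.mkQ (ρ g y) := fun g y => rfl
  have : Nontrivial (M ⧸ F) := Submodule.Quotient.nontrivial_iff.2 hne
  have hM : Finite (M ⧸ F) := Module.finite_of_finite K
  have hdvd : p ∣ Nat.card (M ⧸ F) := by
    rw [Module.natCard_eq_pow_finrank (K := K)]
    exact hp.trans (dvd_pow_self _ (Module.finrank_pos (R := K)).ne')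
  obtain ⟨b, hb, hb0⟩ := hΓ.exists_fixed_point_of_prime_dvd_card_of_fixed_point (M ⧸ F) hdvd
    (a := 0) (fun g => by rw [← map_zero F.mkQ, hsmul, map_zero])
  obtain ⟨w, rfl⟩ := F.mkQ_surjective b
  refine ⟨w, fun hw => hb0 ?_, fun g => ?_⟩
  · exact ((Submodule.Quotient.mk_eq_zero F).2 hw).symm
  · exact (Submodule.Quotient.eq F).1 (hb g)

/-- One step in the construction of a flag for a `p`-group: if the only vectors which are fixed
modulo `F` lie in `F'`, and `F'/F` is at most one-dimensional, then `F'/F` is fixed. -/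
theorem IsPGroup.fixes_mod [Module.Finite K M] (hp : p ∣ Nat.card K) (hΓ : IsPGroup p Γ)
    (ρ : Γ →* (M ≃ₗ[K] M)) (F F' : Submodule K M) (hF : ∀ g, ∀ f ∈ F, ρ g f - f ∈ F) (hne : F ≠ ⊤)
    (hR : ∀ w, (∀ g, ρ g w - w ∈ F) → w ∈ F')
    (hline : ∀ w ∈ F', w ∉ F → ∀ f ∈ F', ∃ c : K, f - c • w ∈ F) :
    ∀ g, ∀ f ∈ F', ρ g f - f ∈ F := by
  intro g f hf
  obtain ⟨w, hwF, hw⟩ := hΓ.exists_fixed_mod hp ρ F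
    (fun g f hf => by simpa using add_mem (hF g f hf) hf) hne
  obtain ⟨c, hc⟩ := hline w (hR w hw) hwF f hf
  have h1 := add_mem (hF g _ hc) (F.smul_mem c (hw g))
  rw [map_sub, map_smul] at h1
  convert h1 using 1
  rw [smul_sub]
  abel

end FixedVectors

section Sylow

variable {K : Type*} [Field K]

/-- The full flag in the split octonions stabilized by a Borel subgroup of `G₂(K)`; its `k`-th
member has dimension `k + 1` and contains `1`. -/
def zornFlag (K : Type*) [Field K] (k : ℕ) : Submodule K (ZornMatrix K) where
  carrier := {w | (k < 7 → w.2.2.1 0 = 0) ∧ (k < 6 → w.2.1 2 = 0) ∧ (k < 5 → w.2.1 1 = 0) ∧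
    (k < 4 → w.1 = w.2.2.2) ∧ (k < 3 → w.2.2.1 1 = 0) ∧ (k < 2 → w.2.2.1 2 = 0) ∧
    (k < 1 → w.2.1 0 = 0)}
  zero_mem' := by simp
  add_mem' := by
    rintro x y ⟨h1, h2, h3, h4, h5, h6, h7⟩ ⟨k1, k2, k3, k4, k5, k6, k7⟩
    refine ⟨fun h => ?_, fun h => ?_, fun h => ?_, fun h => ?_, fun h => ?_, fun h => ?_,
      fun h => ?_⟩
    · simp [h1 h, k1 h]
    · simp [h2 h, k2 h]
    · simp [h3 h, k3 h]
    · simp [h4 h, k4 h]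
    · simp [h5 h, k5 h]
    · simp [h6 h, k6 h]
    · simp [h7 h, k7 h]
  smul_mem' := by
    rintro c x ⟨h1, h2, h3, h4, h5, h6, h7⟩
    refine ⟨fun h => ?_, fun h => ?_, fun h => ?_, fun h => ?_, fun h => ?_, fun h => ?_,
      fun h => ?_⟩
    · simp [h1 h]
    · simp [h2 h]
    · simp [h3 h]
    · simp [h4 h]
    · simp [h5 h]
    · simp [h6 h]
    · simp [h7 h]

theorem mem_zornFlag {k : ℕ} {w : ZornMatrix K} : w ∈ zornFlag K k ↔
    (k < 7 → w.2.2.1 0 = 0) ∧ (k < 6 → w.2.1 2 = 0) ∧ (k < 5 → w.2.1 1 = 0) ∧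
    (k < 4 → w.1 = w.2.2.2) ∧ (k < 3 → w.2.2.1 1 = 0) ∧ (k < 2 → w.2.2.1 2 = 0) ∧
    (k < 1 → w.2.1 0 = 0) := Iff.rfl

theorem zornFlag_ne_top {k : ℕ} (hk : k < 7) : zornFlag K k ≠ ⊤ := by
  intro h
  have := (mem_zornFlag.1 (h ▸ Submodule.mem_top :
    ((0, 0, ![1, 0, 0], 0) : ZornMatrix K) ∈ zornFlag K k)).1 hk
  simp at this

theorem zornFlag_line {k : ℕ} (hk : k < 7) (w f : ZornMatrix K) (hw : w ∈ zornFlag K (k + 1))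
    (hwF : w ∉ zornFlag K k) (hf : f ∈ zornFlag K (k + 1)) :
    ∃ c : K, f - c • w ∈ zornFlag K k := by
  rw [mem_zornFlag] at hw hf hwF
  interval_cases k
  · refine ⟨f.2.1 0 / w.2.1 0, mem_zornFlag.2 ?_⟩
    have : w.2.1 0 ≠ 0 := fun h => hwF (by simp_all)
    simp_all
  · refine ⟨f.2.2.1 2 / w.2.2.1 2, mem_zornFlag.2 ?_⟩
    have : w.2.2.1 2 ≠ 0 := fun h => hwF (by simp_all)
    simp_all
  · refine ⟨f.2.2.1 1 / w.2.2.1 1, mem_zornFlag.2 ?_⟩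
    have : w.2.2.1 1 ≠ 0 := fun h => hwF (by simp_all)
    simp_all
  · refine ⟨(f.1 - f.2.2.2) / (w.1 - w.2.2.2), mem_zornFlag.2 ?_⟩
    have : w.1 - w.2.2.2 ≠ 0 := fun h => hwF (by simp_all [sub_eq_zero])
    simp_all
    field_simp
    ring
  · refine ⟨f.2.1 1 / w.2.1 1, mem_zornFlag.2 ?_⟩
    have : w.2.1 1 ≠ 0 := fun h => hwF (by simp_all)
    simp_all
  · refine ⟨f.2.1 2 / w.2.1 2, mem_zornFlag.2 ?_⟩
    have : w.2.1 2 ≠ 0 := fun h => hwF (by simp_all)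
    simp_all
  · refine ⟨f.2.2.1 0 / w.2.2.1 0, mem_zornFlag.2 ?_⟩
    have : w.2.2.1 0 ≠ 0 := fun h => hwF (by simp_all)
    simp_all

/-- Only members of the next term of the flag are fixed by the two simple root elements modulo a
term of the flag. -/
theorem mem_zornFlag_succ_of_act (h2 : (2 : K) ≠ 0) {k : ℕ} (hk : k < 7) (w : ZornMatrix K)
    (ht : UnipG2.act ⟨1, 0, 0, 0, 0, 0⟩ w - w ∈ zornFlag K k)
    (hv : UnipG2.act ⟨0, 1, 0, 0, 0, 0⟩ w - w ∈ zornFlag K k) : w ∈ zornFlag K (k + 1) := by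
  rw [mem_zornFlag] at ht hv ⊢
  simp only [Prod.fst_sub, Prod.snd_sub, Pi.sub_apply, UnipG2.act_a, UnipG2.act_u₀, UnipG2.act_u₁,
    UnipG2.act_u₂, UnipG2.act_v₀, UnipG2.act_v₁, UnipG2.act_v₂, UnipG2.act_b] at ht hv
  have hx : ∀ x : K, -x = x ↔ x = 0 := fun x =>
    ⟨fun h => by
      have h3 : 2 * x = 0 := by linear_combination -h
      simpa [h2] using h3, fun h => by simp [h]⟩
  have z1 : UnipG2.zeta (⟨1, 0, 0, 0, 0, 0⟩ : UnipG2 K) = 0 := by simp [UnipG2.zeta]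
  have z2 : UnipG2.zeta (⟨0, 1, 0, 0, 0, 0⟩ : UnipG2 K) = 0 := by simp [UnipG2.zeta]
  rw [z1] at ht
  rw [z2] at hv
  clear z1 z2
  interval_cases k <;> simp_all [sub_eq_zero]
  · exact sub_eq_zero.1 (ht.2.2.1.trans ht.2.1)
  · exact sub_eq_zero.1 (ht.2.2.trans ht.2.1)
  · exact sub_eq_zero.1 (ht.2.2.trans ht.2.1)

theorem G2_map_one (g : G2 K) :
    (g : ZornMatrix K ≃ₗ[K] ZornMatrix K) (1, 0, 0, 1) = (1, 0, 0, 1) := by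
  have h1 : ∀ x : ZornMatrix K, ZornMatrix.mul (1, 0, 0, 1) x = x := fun x => by
    simp [ZornMatrix.mul_def]
  have h2 : ∀ x : ZornMatrix K, ZornMatrix.mul x (1, 0, 0, 1) = x := fun x => by
    simp [ZornMatrix.mul_def]
  obtain ⟨y, hy⟩ := (g : ZornMatrix K ≃ₗ[K] ZornMatrix K).surjective (1, 0, 0, 1)
  have := g.2 (1, 0, 0, 1) y
  rw [h1, hy, h2] at this
  exact this.symm

/-- A `p`-subgroup of `G₂(K)` containing the unipotent group acts unitriangularly with respect to
the flag. -/
theorem unitriangular_of_isPGroup [Finite K] {p : ℕ} [Fact p.Prime] (hp : p ∣ Nat.card K)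
    (h2 : (2 : K) ≠ 0) (P : Subgroup (G2 K)) (hP : IsPGroup p P)
    (hR : (UnipG2.toG2 h2).range ≤ P) (k : ℕ) (hk : k < 7) (g : G2 K) (hg : g ∈ P)
    (f : ZornMatrix K) (hf : f ∈ zornFlag K (k + 1)) :
    (g : ZornMatrix K ≃ₗ[K] ZornMatrix K) f - f ∈ zornFlag K k := by
  have h0 : ∀ g : P, ∀ f ∈ zornFlag K 0,
      (g : ZornMatrix K ≃ₗ[K] ZornMatrix K) f - f ∈ zornFlag K 0 := by
    intro g f hf
    have : f = f.1 • ((1, 0, 0, 1) : ZornMatrix K) := by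
      rw [mem_zornFlag] at hf
      apply ZornMatrix.ext_coord <;> simp_all
    rw [this, map_smul, G2_map_one, sub_self]
    exact zero_mem _
  have step : ∀ k < 7, (∀ g : P, ∀ f ∈ zornFlag K k,
      (g : ZornMatrix K ≃ₗ[K] ZornMatrix K) f - f ∈ zornFlag K k) → ∀ g : P,
      ∀ f ∈ zornFlag K (k + 1), (g : ZornMatrix K ≃ₗ[K] ZornMatrix K) f - f ∈ zornFlag K k :=
    fun k hk hF => hP.fixes_mod hp ((G2 K).subtype.comp P.subtype) _ _ hF
      (zornFlag_ne_top hk)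
      (fun w hw => mem_zornFlag_succ_of_act h2 hk w
        (hw ⟨UnipG2.toG2 h2 ⟨1, 0, 0, 0, 0, 0⟩, hR ⟨_, rfl⟩⟩)
        (hw ⟨UnipG2.toG2 h2 ⟨0, 1, 0, 0, 0, 0⟩, hR ⟨_, rfl⟩⟩))
      (fun w hw hwF f hf => zornFlag_line hk w f hw hwF hf)
  have hmono : ∀ k, zornFlag K k ≤ zornFlag K (k + 1) := fun k w hw => by
    rw [mem_zornFlag] at hw ⊢
    refine ⟨fun h => hw.1 ?_, fun h => hw.2.1 ?_, fun h => hw.2.2.1 ?_, fun h => hw.2.2.2.1 ?_,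
      fun h => hw.2.2.2.2.1 ?_, fun h => hw.2.2.2.2.2.1 ?_, fun h => hw.2.2.2.2.2.2 ?_⟩ <;> omega
  have all : ∀ k < 7, ∀ g : P,
      ∀ f ∈ zornFlag K (k + 1), (g : ZornMatrix K ≃ₗ[K] ZornMatrix K) f - f ∈ zornFlag K k := by
    intro k
    induction k with
    | zero => exact fun hk => step 0 hk h0
    | succ k ih => exact fun hk => step _ hk fun g f hf => hmono k (ih (by omega) g f hf)
  exact all k hk ⟨g, hg⟩ f hf

/-- A unitriangular automorphism of the split octonions lies in the image of the unipotent group: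
after multiplication with an element of that image it fixes the lowest weight vector and has a
vanishing coefficient at the root `β`, and then it is trivial. -/
theorem le_range_toG2_of_unitriangular (h2 : (2 : K) ≠ 0) (P : Subgroup (G2 K))
    (hR : (UnipG2.toG2 h2).range ≤ P)
    (hP : ∀ k < 7, ∀ g ∈ P, ∀ f ∈ zornFlag K (k + 1),
      (g : ZornMatrix K ≃ₗ[K] ZornMatrix K) f - f ∈ zornFlag K k) :
    P ≤ (UnipG2.toG2 h2).range := by
  intro g hg
  set x₀ : ZornMatrix K := (0, 0, ![1, 0, 0], 0) with hx₀
  set y₀ : ZornMatrix K := (0, ![1, 0, 0], 0, 0) with hy₀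
  set y₁ : ZornMatrix K := (0, ![0, 1, 0], 0, 0) with hy₁
  set y₂ : ZornMatrix K := (0, ![0, 0, 1], 0, 0) with hy₂
  have mx₀ : x₀ ∈ zornFlag K 7 := by rw [mem_zornFlag]; simp
  have my₂ : y₂ ∈ zornFlag K 6 := by rw [mem_zornFlag]; simp [hy₂]
  have my₁ : y₁ ∈ zornFlag K 5 := by rw [mem_zornFlag]; simp [hy₁]
  have my₀ : y₀ ∈ zornFlag K 1 := by rw [mem_zornFlag]; simp [hy₀]
  have sq₀ : ZornMatrix.mul x₀ x₀ = 0 := by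
    apply ZornMatrix.ext_coord <;> simp [ZornMatrix.mul_def, hx₀]
  have sqy₀ : ZornMatrix.mul y₀ y₀ = 0 := by
    apply ZornMatrix.ext_coord <;> simp [ZornMatrix.mul_def, hy₀]
  have mul₂ : ZornMatrix.mul y₂ x₀ = 0 := by
    apply ZornMatrix.ext_coord <;> simp [ZornMatrix.mul_def, hx₀, hy₂]
  have mul₂' : ZornMatrix.mul x₀ y₂ = 0 := by
    apply ZornMatrix.ext_coord <;> simp [ZornMatrix.mul_def, hx₀, hy₂]
  have mul₁' : ZornMatrix.mul x₀ y₁ = 0 := by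
    apply ZornMatrix.ext_coord <;> simp [ZornMatrix.mul_def, hx₀, hy₁]
  have mul₁ : ZornMatrix.mul y₁ x₀ = 0 := by
    apply ZornMatrix.ext_coord <;> simp [ZornMatrix.mul_def, hx₀, hy₁]
  set A := (g : ZornMatrix K ≃ₗ[K] ZornMatrix K) x₀ with hA
  set C := (g : ZornMatrix K ≃ₗ[K] ZornMatrix K) y₂ with hC
  have hAA : ZornMatrix.mul A A = 0 := by rw [hA, ← g.2 x₀ x₀, sq₀, map_zero]
  have hAf : A.2.2.1 0 = 1 := by
    have := (mem_zornFlag.1 (hP 6 (by norm_num) g hg x₀ mx₀)).1 (by norm_num)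
    simpa [hx₀, sub_eq_zero] using this
  have hCf := mem_zornFlag.1 (hP 5 (by norm_num) g hg y₂ my₂)
  have hC0 : C.2.2.1 0 = 0 := by simpa [hy₂, sub_eq_zero] using hCf.1 (by norm_num)
  have hC2 : C.2.1 2 = 1 := by simpa [hy₂, sub_eq_zero] using hCf.2.1 (by norm_num)
  have hAb : A.2.2.2 = - A.1 := by
    have := congrArg (fun w : ZornMatrix K => w.2.2.1 0) hAA
    simp only [ZornMatrix.mul_v₀, hAf] at this
    have h0 : (0 : ZornMatrix K).2.2.1 0 = 0 := rfl
    rw [h0] at this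
    linear_combination this
  have hAn : A.1 * A.1 + (A.2.1 0 + A.2.1 1 * A.2.2.1 1 + A.2.1 2 * A.2.2.1 2) = 0 := by
    have := congrArg (fun w : ZornMatrix K => w.1) hAA
    simp only [ZornMatrix.mul_a, hAf] at this
    have h0 : (0 : ZornMatrix K).1 = 0 := rfl
    rw [h0] at this
    linear_combination this
  -- the coordinates are read off from the images of the weight vectors `x₀` and `y₂`
  obtain ⟨r, hrt, hr0, hr1, hr2, hr3, hrz⟩ : ∃ r : UnipG2 K, r.t = A.2.1 2 ∧ r.v₀ = C.2.1 1 ∧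
      r.v₁ = A.2.1 1 ∧ r.v₂ = A.1 + r.v₁ * r.t ∧
      r.v₃ = 2 * r.v₂ * r.t - r.v₁ * r.t ^ 2 - A.2.2.1 1 ∧
      r.zeta = r.v₀ * r.v₃ - r.v₁ * r.v₂ - A.2.2.1 2 := by
    refine ⟨⟨A.2.1 2, C.2.1 1, A.2.1 1, A.1 + A.2.1 1 * A.2.1 2,
      2 * (A.1 + A.2.1 1 * A.2.1 2) * A.2.1 2 - A.2.1 1 * (A.2.1 2) ^ 2 - A.2.2.1 1,
      2 * A.2.2.1 2 - C.2.1 1 * (2 * (A.1 + A.2.1 1 * A.2.1 2) * A.2.1 2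
        - A.2.1 1 * (A.2.1 2) ^ 2 - A.2.2.1 1) + A.2.1 1 * (A.1 + A.2.1 1 * A.2.1 2)⟩,
      rfl, rfl, rfl, rfl, rfl, ?_⟩
    simp only [UnipG2.zeta]
    field_simp
    ring
  have hrA : UnipG2.act r x₀ = A := by
    apply ZornMatrix.ext_coord <;>
      simp only [UnipG2.act_a, UnipG2.act_u₀, UnipG2.act_u₁, UnipG2.act_u₂, UnipG2.act_v₀,
        UnipG2.act_v₁, UnipG2.act_v₂, UnipG2.act_b] <;>
      simp [hx₀]
    · rw [hr2]; ring
    · rw [hrz, hr3, hr2, hr1, hrt]; linear_combination -hAn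
    · exact hr1
    · exact hrt
    · exact hAf.symm
    · rw [hr3]; ring
    · rw [hrz]; ring
    · rw [hAb, hr2]; ring
  set k : G2 K := (UnipG2.toG2 h2 r)⁻¹ * g with hk
  have hkP : k ∈ P := mul_mem (inv_mem (hR ⟨r, rfl⟩)) hg
  have hka : ∀ w, (k : ZornMatrix K ≃ₗ[K] ZornMatrix K) w =
      UnipG2.act r⁻¹ ((g : ZornMatrix K ≃ₗ[K] ZornMatrix K) w) := fun w => rfl
  have kx₀ : (k : ZornMatrix K ≃ₗ[K] ZornMatrix K) x₀ = x₀ := by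
    rw [hka, ← hA, ← hrA, ← UnipG2.act_mul h2, inv_mul_cancel, UnipG2.act_one]
  -- annihilation by `x₀` on both sides forces most coordinates to vanish
  have hann : ∀ B : ZornMatrix K, ZornMatrix.mul B x₀ = 0 → ZornMatrix.mul x₀ B = 0 →
      B.1 = 0 ∧ B.2.2.2 = 0 ∧ B.2.1 0 = 0 ∧ B.2.2.1 1 = 0 ∧ B.2.2.1 2 = 0 := by
    intro B h h'
    have e1 := congrArg (fun w : ZornMatrix K => w.1) h
    have e2 := congrArg (fun w : ZornMatrix K => w.2.1 1) h
    have e3 := congrArg (fun w : ZornMatrix K => w.2.1 2) h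
    have e4 := congrArg (fun w : ZornMatrix K => w.2.2.1 0) h
    have e5 := congrArg (fun w : ZornMatrix K => w.2.2.1 0) h'
    simp only [ZornMatrix.mul_a, ZornMatrix.mul_u₁, ZornMatrix.mul_u₂, ZornMatrix.mul_v₀]
      at e1 e2 e3 e4 e5
    simp [hx₀] at e1 e2 e3 e4 e5
    exact ⟨e5, e4, e1, e3, e2⟩
  have ky₂ : (k : ZornMatrix K ≃ₗ[K] ZornMatrix K) y₂ = y₂ := by
    have h1 : ((k : ZornMatrix K ≃ₗ[K] ZornMatrix K) y₂).2.1 1 = 0 := by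
      rw [hka, ← hC, UnipG2.act_u₁, hC0, hC2, UnipG2.inv_v₀, hr0]; ring
    have h3 := mem_zornFlag.1 (hP 5 (by norm_num) k hkP y₂ my₂)
    have h4 := k.2 y₂ x₀
    have h5 := k.2 x₀ y₂
    rw [mul₂, map_zero, kx₀] at h4
    rw [mul₂', map_zero, kx₀] at h5
    obtain ⟨ha, hb, hu0, hv1, hv2⟩ := hann _ h4.symm h5.symm
    apply ZornMatrix.ext_coord
    · simpa [hy₂] using ha
    · simpa [hy₂] using hu0
    · simpa [hy₂] using h1
    · simpa [sub_eq_zero] using h3.2.1 (by norm_num)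
    · simpa [sub_eq_zero] using h3.1 (by norm_num)
    · simpa [hy₂] using hv1
    · simpa [hy₂] using hv2
    · simpa [hy₂] using hb
  have ky₁ : (k : ZornMatrix K ≃ₗ[K] ZornMatrix K) y₁ = y₁ := by
    have h3 := mem_zornFlag.1 (hP 4 (by norm_num) k hkP y₁ my₁)
    have h4 := k.2 y₁ x₀
    have h5 := k.2 x₀ y₁
    rw [mul₁, map_zero, kx₀] at h4
    rw [mul₁', map_zero, kx₀] at h5
    obtain ⟨ha, hb, hu0, hv1, hv2⟩ := hann _ h4.symm h5.symm
    apply ZornMatrix.ext_coord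
    · simpa [hy₁] using ha
    · simpa [hy₁] using hu0
    · simpa [sub_eq_zero] using h3.2.2.1 (by norm_num)
    · simpa [sub_eq_zero] using h3.2.1 (by norm_num)
    · simpa [sub_eq_zero] using h3.1 (by norm_num)
    · simpa [hy₁] using hv1
    · simpa [hy₁] using hv2
    · simpa [hy₁] using hb
  have ky₀ : (k : ZornMatrix K ≃ₗ[K] ZornMatrix K) y₀ = y₀ := by
    have h3 := mem_zornFlag.1 (hP 0 (by norm_num) k hkP y₀ my₀)
    have h4 := k.2 y₀ y₀
    rw [sqy₀, map_zero] at h4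
    have hv0 := h3.1 (by norm_num)
    have hu2 := h3.2.1 (by norm_num)
    have hu1 := h3.2.2.1 (by norm_num)
    have hab := h3.2.2.2.1 (by norm_num)
    have hv1 := h3.2.2.2.2.1 (by norm_num)
    have hv2 := h3.2.2.2.2.2.1 (by norm_num)
    have hu0 := h3.2.2.2.2.2.2 (by norm_num)
    simp [hy₀, sub_eq_zero] at hv0 hu2 hu1 hab hv1 hv2 hu0
    have h6 := congrArg (fun w : ZornMatrix K => w.1) h4
    simp only [ZornMatrix.mul_a] at h6
    rw [hv0, hv1, hv2] at h6
    have ha : ((k : ZornMatrix K ≃ₗ[K] ZornMatrix K) y₀).1 = 0 := by simpa using h6.symm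
    apply ZornMatrix.ext_coord
    · exact ha
    · simpa [hy₀] using hu0
    · simpa [hy₀] using hu1
    · simpa [hy₀] using hu2
    · exact hv0
    · exact hv1
    · exact hv2
    · exact hab ▸ ha
  have hmul : ∀ x y, (k : ZornMatrix K ≃ₗ[K] ZornMatrix K) x = x →
      (k : ZornMatrix K ≃ₗ[K] ZornMatrix K) y = y →
      (k : ZornMatrix K ≃ₗ[K] ZornMatrix K) (ZornMatrix.mul x y) = ZornMatrix.mul x y :=
    fun x y hx hy => by rw [k.2 x y, hx, hy]
  have hk1 : k = 1 := by
    apply Subtype.ext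
    apply LinearEquiv.ext
    intro w
    have hw : w = w.1 • ZornMatrix.mul y₀ x₀ + w.2.2.2 • ZornMatrix.mul x₀ y₀ + w.2.1 0 • y₀
        + w.2.1 1 • y₁ + w.2.1 2 • y₂ + w.2.2.1 0 • x₀ + w.2.2.1 1 • ZornMatrix.mul y₀ y₂
        - w.2.2.1 2 • ZornMatrix.mul y₀ y₁ := by
      apply ZornMatrix.ext_coord <;> simp [ZornMatrix.mul_def, hx₀, hy₀, hy₁, hy₂, cross_apply]
    rw [hw]
    simp only [map_add, map_sub, map_smul, hmul y₀ x₀ ky₀ kx₀, hmul x₀ y₀ kx₀ ky₀, ky₀, ky₁, ky₂,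
      kx₀, hmul y₀ y₂ ky₀ ky₂, hmul y₀ y₁ ky₀ ky₁]
    rfl
  refine ⟨r, ?_⟩
  rw [← mul_one (UnipG2.toG2 h2 r), ← hk1, hk, mul_inv_cancel_left]

theorem UnipG2.toG2_injective (h2 : (2 : K) ≠ 0) : Function.Injective (toG2 h2) := by
  rw [injective_iff_map_eq_one]
  intro g hg
  have h : ∀ w, act g w = w := fun w =>
    congrArg (fun k : G2 K => (k : ZornMatrix K ≃ₗ[K] ZornMatrix K) w) hg
  have h1 := h (0, 0, ![1, 0, 0], 0)
  have h2' := congrArg (fun w : ZornMatrix K => w.2.1 1) (h (0, ![0, 0, 1], 0, 0))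
  have hv0 : g.v₀ = 0 := by simpa [act_u₁] using h2'
  have ht : g.t = 0 := by simpa [act_u₂] using congrArg (fun w : ZornMatrix K => w.2.1 2) h1
  have hv1 : g.v₁ = 0 := by simpa [act_u₁] using congrArg (fun w : ZornMatrix K => w.2.1 1) h1
  have hv2 : g.v₂ = 0 := by
    simpa [act_a, hv1] using congrArg (fun w : ZornMatrix K => w.1) h1
  have hv3 : g.v₃ = 0 := by
    simpa [act_v₁, hv2, hv1] using congrArg (fun w : ZornMatrix K => w.2.2.1 1) h1
  have hz : g.z = 0 := by
    simpa [act_v₂, hv2, hv1, hv0, zeta, h2] using congrArg (fun w : ZornMatrix K => w.2.2.1 2) h1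
  ext <;> assumption

/-- A Sylow `p`-subgroup of `G₂(K)` is isomorphic to the unipotent group. -/
theorem exists_mulEquiv_unipG2 [Finite K] {p n : ℕ} [Fact p.Prime] (hK : Nat.card K = p ^ n)
    (h2 : (2 : K) ≠ 0) (P : Sylow p (G2 K)) : Nonempty (P ≃* UnipG2 K) := by
  have hdvd : p ∣ Nat.card K := by
    rw [hK]
    refine dvd_pow_self p fun h => ?_
    rw [h, pow_zero] at hK
    exact (Finite.one_lt_card (α := K)).ne' hK
  have : Finite (ZornMatrix K ≃ₗ[K] ZornMatrix K) :=
    Finite.of_injective (fun g => (g : ZornMatrix K → ZornMatrix K)) DFunLike.coe_injective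
  have hU : IsPGroup p (UnipG2 K) :=
    IsPGroup.of_card (n := n * 6) (by rw [UnipG2.card, hK, pow_mul])
  obtain ⟨Q, hQ⟩ := (hU.of_surjective _ (UnipG2.toG2 h2).rangeRestrict_surjective).exists_le_sylow
  have hQR : (Q : Subgroup (G2 K)) = (UnipG2.toG2 h2).range :=
    le_antisymm (le_range_toG2_of_unitriangular h2 Q hQ fun k hk g hg f hf =>
      unitriangular_of_isPGroup hdvd h2 Q Q.2 hQ k hk g hg f hf) hQ
  exact ⟨(P.equiv Q).trans ((MulEquiv.subgroupCongr hQR).trans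
    (MonoidHom.ofInjective (UnipG2.toG2_injective h2)).symm)⟩

end Sylow

/-! ### Characteristic subgroups in coordinates -/

section Coordinates

variable {K S : Type*} [Field K] [Group S] (e : S ≃* UnipG2 K)

theorem commutator_eq_one_iff (x y : S) : ⁅x, y⁆ = 1 ↔
    (e y).t * (e x).v₀ = (e x).t * (e y).v₀ ∧
    2 * (e y).t * (e x).v₁ + (e y).t ^ 2 * (e x).v₀ =
      2 * (e x).t * (e y).v₁ + (e x).t ^ 2 * (e y).v₀ ∧
    3 * (e y).t * (e x).v₂ + 3 * (e y).t ^ 2 * (e x).v₁ + (e y).t ^ 3 * (e x).v₀ =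
      3 * (e x).t * (e y).v₂ + 3 * (e x).t ^ 2 * (e y).v₁ + (e x).t ^ 3 * (e y).v₀ ∧
    (e (x * y)).z = (e (y * x)).z := by
  rw [commutatorElement_eq_one_iff_mul_comm, ← e.injective.eq_iff, UnipG2.ext_iff]
  simp only [map_mul, UnipG2.mul_t, UnipG2.mul_v₀, UnipG2.mul_v₁, UnipG2.mul_v₂, UnipG2.mul_v₃]
  constructor
  · rintro ⟨-, -, h1, h2, h3, h4⟩
    exact ⟨by linear_combination h1, by linear_combination h2, by linear_combination h3, h4⟩
  · rintro ⟨h1, h2, h3, h4⟩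
    exact ⟨by ring, by ring, by linear_combination h1, by linear_combination h2,
      by linear_combination h3, h4⟩

theorem commutator_t (x y : S) : (e ⁅x, y⁆).t = 0 := by
  simp [commutatorElement_def]

theorem commutator_v₀ (x y : S) : (e ⁅x, y⁆).v₀ = 0 := by
  simp [commutatorElement_def]

theorem commutator_v₁_eq_zero_iff (x y : S) : (e ⁅x, y⁆).v₁ = 0 ↔
    (e y).t * (e x).v₀ = (e x).t * (e y).v₀ := by
  simp only [commutatorElement_def, map_mul, map_inv, UnipG2.mul_v₁, UnipG2.mul_v₀, UnipG2.inv_v₁,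
    UnipG2.inv_v₀, UnipG2.inv_t]
  constructor <;> intro h <;> linear_combination h

theorem commutator_v₂_eq_zero_iff (x y : S)
    (h1 : (e y).t * (e x).v₀ = (e x).t * (e y).v₀) : (e ⁅x, y⁆).v₂ = 0 ↔
    2 * (e y).t * (e x).v₁ + (e y).t ^ 2 * (e x).v₀ =
      2 * (e x).t * (e y).v₁ + (e x).t ^ 2 * (e y).v₀ := by
  simp only [commutatorElement_def, map_mul, map_inv, UnipG2.mul_v₂, UnipG2.mul_v₁, UnipG2.mul_v₀,
    UnipG2.inv_v₂, UnipG2.inv_v₁, UnipG2.inv_v₀, UnipG2.inv_t]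
  constructor <;> intro h
  · linear_combination h + 2 * ((e x).t + (e y).t) * h1
  · linear_combination h - 2 * ((e x).t + (e y).t) * h1

theorem commutator_v₃_eq_zero_iff (x y : S)
    (h1 : (e y).t * (e x).v₀ = (e x).t * (e y).v₀)
    (h2 : 2 * (e y).t * (e x).v₁ + (e y).t ^ 2 * (e x).v₀ =
      2 * (e x).t * (e y).v₁ + (e x).t ^ 2 * (e y).v₀) : (e ⁅x, y⁆).v₃ = 0 ↔
    3 * (e y).t * (e x).v₂ + 3 * (e y).t ^ 2 * (e x).v₁ + (e y).t ^ 3 * (e x).v₀ =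
      3 * (e x).t * (e y).v₂ + 3 * (e x).t ^ 2 * (e y).v₁ + (e x).t ^ 3 * (e y).v₀ := by
  simp only [commutatorElement_def, map_mul, map_inv, UnipG2.mul_v₃, UnipG2.mul_v₂, UnipG2.mul_v₁,
    UnipG2.mul_v₀, UnipG2.inv_v₃, UnipG2.inv_v₂, UnipG2.inv_v₁, UnipG2.inv_v₀, UnipG2.inv_t]
  constructor <;> intro h
  · linear_combination h + 3 * ((e x).t + (e y).t) * h2 - 3 * ((e x).t + (e y).t) ^ 2 * h1
  · linear_combination h - 3 * ((e x).t + (e y).t) * h2 + 3 * ((e x).t + (e y).t) ^ 2 * h1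

section

variable (h2 : (2 : K) ≠ 0) (h3 : (3 : K) ≠ 0)
include h2 h3

theorem mem_Zc_one {x : S} : x ∈ Zc S 1 ↔ (e x).t = 0 ∧ (e x).v₀ = 0 ∧ (e x).v₁ = 0 ∧
    (e x).v₂ = 0 ∧ (e x).v₃ = 0 := by
  rw [Zc, Subgroup.mem_upperCentralSeries_succ_iff]
  simp only [Subgroup.upperCentralSeries_zero, Subgroup.mem_bot]
  constructor
  · intro h
    obtain ⟨a1, a2, a3, -⟩ := (commutator_eq_one_iff e _ _).1 (h (e.symm ⟨1, 0, 0, 0, 0, 0⟩))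
    obtain ⟨b1, -, -, b4⟩ := (commutator_eq_one_iff e _ _).1 (h (e.symm ⟨0, 1, 0, 0, 0, 0⟩))
    simp only [map_mul, UnipG2.mul_z, MulEquiv.apply_symm_apply] at a1 a2 a3 b1 b4
    have t0 : (e x).t = 0 := by linear_combination -b1
    have v0 : (e x).v₀ = 0 := by linear_combination a1
    rw [v0, t0] at a2 a3
    have v1 : (e x).v₁ = 0 := mul_left_cancel₀ h2 (by linear_combination a2)
    rw [v1] at a3
    have v2 : (e x).v₂ = 0 := mul_left_cancel₀ h3 (by linear_combination a3)
    rw [v0, v1, v2, t0] at b4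
    exact ⟨t0, v0, v1, v2, mul_left_cancel₀ h2 (by linear_combination -b4)⟩
  · rintro ⟨t0, v0, v1, v2, v3⟩ y
    rw [commutator_eq_one_iff e]
    simp [t0, v0, v1, v2, v3, add_comm]

theorem mem_Zc_two {x : S} : x ∈ Zc S 2 ↔ (e x).t = 0 ∧ (e x).v₀ = 0 ∧ (e x).v₁ = 0 ∧
    (e x).v₂ = 0 := by
  rw [Zc, Subgroup.mem_upperCentralSeries_succ_iff]
  simp only [mem_Zc_one e h2 h3]
  constructor
  · intro h
    obtain ⟨-, -, a1, a2, a3⟩ := h (e.symm ⟨1, 0, 0, 0, 0, 0⟩)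
    obtain ⟨-, -, b1, -, -⟩ := h (e.symm ⟨0, 1, 0, 0, 0, 0⟩)
    rw [commutator_v₁_eq_zero_iff] at a1 b1
    rw [commutator_v₂_eq_zero_iff _ _ _ a1] at a2
    rw [commutator_v₃_eq_zero_iff _ _ _ a1 a2] at a3
    simp only [MulEquiv.apply_symm_apply] at a1 a2 a3 b1
    have t0 : (e x).t = 0 := by linear_combination -b1
    have v0 : (e x).v₀ = 0 := by linear_combination a1
    rw [v0, t0] at a2 a3
    have v1 : (e x).v₁ = 0 := mul_left_cancel₀ h2 (by linear_combination a2)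
    rw [v1] at a3
    exact ⟨t0, v0, v1, mul_left_cancel₀ h3 (by linear_combination a3)⟩
  · rintro ⟨t0, v0, v1, v2⟩ y
    have a1 : (e y).t * (e x).v₀ = (e x).t * (e y).v₀ := by rw [t0, v0]; ring
    have a2 : 2 * (e y).t * (e x).v₁ + (e y).t ^ 2 * (e x).v₀ =
      2 * (e x).t * (e y).v₁ + (e x).t ^ 2 * (e y).v₀ := by rw [t0, v0, v1]; ring
    refine ⟨commutator_t _ _ _, commutator_v₀ _ _ _, (commutator_v₁_eq_zero_iff _ _ _).2 a1,
      (commutator_v₂_eq_zero_iff _ _ _ a1).2 a2, (commutator_v₃_eq_zero_iff _ _ _ a1 a2).2 ?_⟩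
    rw [t0, v0, v1, v2]; ring

theorem mem_Zc_three {x : S} : x ∈ Zc S 3 ↔ (e x).t = 0 ∧ (e x).v₀ = 0 ∧ (e x).v₁ = 0 := by
  rw [Zc, Subgroup.mem_upperCentralSeries_succ_iff]
  simp only [mem_Zc_two e h2 h3]
  constructor
  · intro h
    obtain ⟨-, -, a1, a2⟩ := h (e.symm ⟨1, 0, 0, 0, 0, 0⟩)
    obtain ⟨-, -, b1, -⟩ := h (e.symm ⟨0, 1, 0, 0, 0, 0⟩)
    rw [commutator_v₁_eq_zero_iff] at a1 b1
    rw [commutator_v₂_eq_zero_iff _ _ _ a1] at a2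
    simp only [MulEquiv.apply_symm_apply] at a1 a2 b1
    have t0 : (e x).t = 0 := by linear_combination -b1
    have v0 : (e x).v₀ = 0 := by linear_combination a1
    rw [v0, t0] at a2
    exact ⟨t0, v0, mul_left_cancel₀ h2 (by linear_combination a2)⟩
  · rintro ⟨t0, v0, v1⟩ y
    have a1 : (e y).t * (e x).v₀ = (e x).t * (e y).v₀ := by rw [t0, v0]; ring
    refine ⟨commutator_t _ _ _, commutator_v₀ _ _ _, (commutator_v₁_eq_zero_iff _ _ _).2 a1,
      (commutator_v₂_eq_zero_iff _ _ _ a1).2 ?_⟩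
    rw [t0, v0, v1]; ring

theorem mem_Zc_four {x : S} : x ∈ Zc S 4 ↔ (e x).t = 0 ∧ (e x).v₀ = 0 := by
  rw [Zc, Subgroup.mem_upperCentralSeries_succ_iff]
  simp only [mem_Zc_three e h2 h3]
  constructor
  · intro h
    obtain ⟨-, -, a1⟩ := h (e.symm ⟨1, 0, 0, 0, 0, 0⟩)
    obtain ⟨-, -, b1⟩ := h (e.symm ⟨0, 1, 0, 0, 0, 0⟩)
    rw [commutator_v₁_eq_zero_iff] at a1 b1
    simp only [MulEquiv.apply_symm_apply] at a1 b1
    exact ⟨by linear_combination -b1, by linear_combination a1⟩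
  · rintro ⟨t0, v0⟩ y
    refine ⟨commutator_t _ _ _, commutator_v₀ _ _ _, (commutator_v₁_eq_zero_iff _ _ _).2 ?_⟩
    rw [t0, v0]; ring

theorem commutator_mem_Zc_three_iff {x y : S} : ⁅x, y⁆ ∈ Zc S 3 ↔
    (e y).t * (e x).v₀ = (e x).t * (e y).v₀ := by
  rw [mem_Zc_three e h2 h3, commutator_v₁_eq_zero_iff]
  simp only [commutator_t, commutator_v₀, true_and]

theorem commutator_mem_Zc_two_iff {x y : S} : ⁅x, y⁆ ∈ Zc S 2 ↔
    (e y).t * (e x).v₀ = (e x).t * (e y).v₀ ∧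
    2 * (e y).t * (e x).v₁ + (e y).t ^ 2 * (e x).v₀ =
      2 * (e x).t * (e y).v₁ + (e x).t ^ 2 * (e y).v₀ := by
  rw [mem_Zc_two e h2 h3, commutator_v₁_eq_zero_iff]
  simp only [commutator_t, commutator_v₀, true_and]
  exact and_congr_right fun h => commutator_v₂_eq_zero_iff e x y h

theorem commutator_mem_Zc_one_iff {x y : S} : ⁅x, y⁆ ∈ Zc S 1 ↔
    (e y).t * (e x).v₀ = (e x).t * (e y).v₀ ∧
    2 * (e y).t * (e x).v₁ + (e y).t ^ 2 * (e x).v₀ =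
      2 * (e x).t * (e y).v₁ + (e x).t ^ 2 * (e y).v₀ ∧
    3 * (e y).t * (e x).v₂ + 3 * (e y).t ^ 2 * (e x).v₁ + (e y).t ^ 3 * (e x).v₀ =
      3 * (e x).t * (e y).v₂ + 3 * (e x).t ^ 2 * (e y).v₁ + (e x).t ^ 3 * (e y).v₀ := by
  rw [mem_Zc_one e h2 h3, commutator_v₁_eq_zero_iff]
  simp only [commutator_t, commutator_v₀, true_and]
  exact and_congr_right fun h => (and_congr_right_iff.2 fun h' => by
    rw [commutator_v₃_eq_zero_iff e x y h ((commutator_v₂_eq_zero_iff e x y h).1 h')]).trans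
    (and_congr_left' (commutator_v₂_eq_zero_iff e x y h))

theorem mem_Q2 {x : S} : x ∈ Q2 S ↔ (e x).v₀ = 0 := by
  rw [Q2, Subgroup.mem_centralizer_iff]
  constructor
  · intro h
    have h1 := h (e.symm ⟨0, 0, 0, 0, 1, 0⟩) ((mem_Zc_two e h2 h3).2 (by simp))
    have h4 := congrArg (fun y => (e y).z) h1
    simp only [map_mul, MulEquiv.apply_symm_apply, UnipG2.mul_z] at h4
    exact mul_left_cancel₀ h2 (by linear_combination -h4)
  · intro h y hy
    obtain ⟨a1, a2, a3, a4⟩ := (mem_Zc_two e h2 h3).1 hy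
    rw [← commutatorElement_eq_one_iff_mul_comm, commutator_eq_one_iff e]
    simp only [map_mul, UnipG2.mul_z, a1, a2, a3, a4, h]
    refine ⟨?_, ?_, ?_, ?_⟩ <;> ring

theorem mem_Q1 {x : S} : x ∈ Q1 S ↔ (e x).t = 0 := by
  have hQ : x ∈ Q1 S ↔ ∀ y ∈ Zc S 3, ⁅x, y⁆ ∈ Zc S 1 := by
    rw [Q1, Subgroup.mem_comap, Subgroup.mem_centralizer_iff]
    simp only [Subgroup.coe_map, Set.forall_mem_image, SetLike.mem_coe]
    refine forall₂_congr fun y _ => ?_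
    rw [← QuotientGroup.eq_one_iff, ← QuotientGroup.mk'_apply, map_commutatorElement,
      commutatorElement_eq_one_iff_mul_comm, eq_comm]
  rw [hQ]
  constructor
  · intro h
    have h1 := h (e.symm ⟨0, 0, 0, 1, 0, 0⟩) ((mem_Zc_three e h2 h3).2 (by simp))
    rw [commutator_mem_Zc_one_iff e h2 h3] at h1
    simp only [MulEquiv.apply_symm_apply] at h1
    exact mul_left_cancel₀ h3 (by linear_combination -h1.2.2)
  · intro h y hy
    obtain ⟨a1, a2, a3⟩ := (mem_Zc_three e h2 h3).1 hy
    rw [commutator_mem_Zc_one_iff e h2 h3, a1, a2, a3, h]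
    refine ⟨?_, ?_, ?_⟩ <;> ring

/-- Every central element of `S` is a commutator of a given element with an element of `Z₂(S)`. -/
theorem mem_Zc_one_eq_commutator {x g : S} (hx : x ∈ Zc S 1) (hg : (e g).v₀ ≠ 0) :
    x = ⁅g, e.symm ⟨0, 0, 0, 0, (e x).z / (2 * (e g).v₀), 0⟩⁆ := by
  obtain ⟨a1, a2, a3, a4, a5⟩ := (mem_Zc_one e h2 h3).1 hx
  rw [commutatorElement_def, eq_mul_inv_iff_mul_eq, eq_mul_inv_iff_mul_eq]
  apply e.injective
  ext <;> simp [a1, a2, a3, a4, a5]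
  · ring
  · field_simp
    ring

theorem mem_commutator_iff {x : S} : x ∈ commutator S ↔ (e x).t = 0 ∧ (e x).v₀ = 0 := by
  have hmem : ∀ a b : S, ⁅a, b⁆ ∈ commutator S := fun a b =>
    Subgroup.commutator_mem_commutator (Subgroup.mem_top _) (Subgroup.mem_top _)
  rw [← mem_Zc_four e h2 h3]
  constructor
  · exact fun hx => (Subgroup.commutator_le.2 fun a _ b _ => (mem_Zc_four e h2 h3).2
      ⟨commutator_t e a b, commutator_v₀ e a b⟩) hx
  · intro hx
    obtain ⟨ht, hv⟩ := (mem_Zc_four e h2 h3).1 hx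
    set X := e x with hX
    -- modulo the centre, `x` is the commutator of a cubic form with the root element `α`
    set a := e.symm ⟨0, X.v₁, (X.v₂ + X.v₁) / 2, (X.v₃ + 3 * ((X.v₂ + X.v₁) / 2) - X.v₁) / 3, 0, 0⟩
      with ha
    set b := e.symm ⟨1, 0, 0, 0, 0, 0⟩ with hb
    have hz : ⁅a, b⁆⁻¹ * x ∈ Zc S 1 := by
      rw [mem_Zc_one e h2 h3]
      simp only [commutatorElement_def, map_mul, map_inv, UnipG2.mul_t, UnipG2.mul_v₀,
        UnipG2.mul_v₁, UnipG2.mul_v₂, UnipG2.mul_v₃, UnipG2.inv_t, UnipG2.inv_v₀, UnipG2.inv_v₁,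
        UnipG2.inv_v₂, UnipG2.inv_v₃, ha, hb, MulEquiv.apply_symm_apply, ← hX, ht, hv]
      refine ⟨by ring, by ring, by ring, ?_, ?_⟩ <;> field_simp <;> ring
    have hg : (e (e.symm ⟨0, 1, 0, 0, 0, 0⟩)).v₀ ≠ 0 := by simp
    rw [← mul_inv_cancel_left ⁅a, b⁆ x, mem_Zc_one_eq_commutator e h2 h3 hz hg]
    exact mul_mem (hmem _ _) (hmem _ _)

end

theorem card_eq_of_param {A : Type*} (E : Subgroup S) (f : A → UnipG2 K)
    (hf : Function.Injective f) (h : ∀ x, x ∈ E ↔ ∃ a, f a = e x) : Nat.card E = Nat.card A := by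
  refine (Nat.card_congr (Equiv.ofBijective (fun a => (⟨e.symm (f a), (h _).2 ⟨a, by simp⟩⟩ : E))
    ⟨fun a b hab => hf ?_, fun x => ?_⟩)).symm
  · simpa using hab
  · obtain ⟨a, ha⟩ := (h _).1 x.2
    exact ⟨a, Subtype.ext (by simp [ha])⟩

end Coordinates

/-! ### Sylow subgroups of `SL₃(K)` -/

section SL3

open Matrix

/-- A group of order `q ^ 3` embedding in `SL₃(K)` is isomorphic to a Sylow subgroup, since
`|GL₃(K)| = q ^ 3 (q ^ 3 - 1) (q ^ 2 - 1) (q - 1)`. -/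
theorem exists_mulEquiv_sylow_SL3 {K H : Type*} [Field K] [Finite K] [Group H] {p n : ℕ}
    [Fact p.Prime] (hK : Nat.card K = p ^ n) (hn : n ≠ 0)
    (f : H →* SpecialLinearGroup (Fin 3) K)
    (hf : Function.Injective f) (hH : Nat.card H = (p ^ n) ^ 3) :
    ∃ T : Sylow p (SpecialLinearGroup (Fin 3) K), Nonempty (H ≃* T) := by
  have := Fintype.ofFinite K
  have hH' : IsPGroup p H := IsPGroup.of_card (n := n * 3) (by rw [hH, pow_mul])
  obtain ⟨T, hT⟩ := (hH'.of_surjective _ f.rangeRestrict_surjective).exists_le_sylow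
  have hR : Nat.card f.range = (p ^ n) ^ 3 := by
    rw [← hH]
    exact (Nat.card_congr (MonoidHom.ofInjective hf).toEquiv).symm
  have hdvd : Nat.card T ∣ (p ^ n) ^ 3 := by
    obtain ⟨m, hm⟩ := IsPGroup.iff_card.1 T.2
    have h1 : Nat.card T ∣ Nat.card (GL (Fin 3) K) :=
      (Subgroup.card_subgroup_dvd_card _).trans
        (Subgroup.card_dvd_of_injective SpecialLinearGroup.toGL SpecialLinearGroup.toGL_injective)
    rw [card_GL_field, ← Nat.card_eq_fintype_card, hK, Fin.prod_univ_three] at h1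
    set q := p ^ n with hq
    have hq1 : 1 ≤ q := Nat.one_le_pow _ _ (Fact.out : p.Prime).pos
    have hpq : p ∣ q := dvd_pow_self p hn
    have hcop : ∀ j, j ≠ 0 → p.Coprime (q ^ j - 1) := fun j hj => by
      rw [(Fact.out : p.Prime).coprime_iff_not_dvd]
      intro hd
      have h5 := (Nat.dvd_sub_iff_right (Nat.one_le_pow j q hq1) (hpq.trans (dvd_pow_self q hj))).1
        hd
      exact (Fact.out : p.Prime).one_lt.ne' (Nat.dvd_one.1 h5)
    have h2 : (q ^ 3 - q ^ ((0 : Fin 3) : ℕ)) * (q ^ 3 - q ^ ((1 : Fin 3) : ℕ))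
        * (q ^ 3 - q ^ ((2 : Fin 3) : ℕ)) = q ^ 3 * ((q ^ 3 - 1) * (q ^ 2 - 1) * (q ^ 1 - 1)) := by
      have e1 : q ^ 3 - q ^ ((1 : Fin 3) : ℕ) = q * (q ^ 2 - 1) := by
        rw [Nat.mul_sub]; simp; ring_nf
      have e2 : q ^ 3 - q ^ ((2 : Fin 3) : ℕ) = q ^ 2 * (q ^ 1 - 1) := by
        rw [Nat.mul_sub]; simp; ring_nf
      rw [e1, e2]
      simp only [Fin.val_zero, pow_zero]
      ring
    rw [h2, hm] at h1
    rw [hm]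
    refine Nat.Coprime.dvd_of_dvd_mul_right ?_ h1
    exact Nat.Coprime.pow_left _ (((hcop 3 (by norm_num)).mul_right
      (hcop 2 (by norm_num))).mul_right (hcop 1 (by norm_num)))
  have hle : f.range = T := Subgroup.eq_of_le_of_card_ge hT (by
    rw [hR]; exact Nat.le_of_dvd (by have := (Fact.out : p.Prime).pos; positivity) hdvd)
  exact ⟨T, ⟨(MonoidHom.ofInjective hf).trans (MulEquiv.subgroupCongr hle)⟩⟩

end SL3

/-! ### Commutators and powers -/

section Prelim

variable {S : Type*} [Group S] {E : Subgroup S} {p : ℕ}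

theorem mem_normalizer_of_commutator [Finite S] {x : S} (h : ∀ y ∈ E, ⁅x, y⁆ ∈ E) :
    x ∈ Subgroup.normalizer (E : Set S) :=
  Subgroup.mem_normalizer_fintype fun y hy => by
    have := mul_mem (h y hy) hy
    rwa [commutatorElement_def, inv_mul_cancel_right] at this

theorem commutator_mem_of_mem_normalizer {x y : S} (h : x ∈ Subgroup.normalizer (E : Set S))
    (hy : y ∈ E) : ⁅x, y⁆ ∈ E := by
  rw [commutatorElement_def]
  exact mul_mem ((Subgroup.mem_normalizer_iff.1 h y).1 hy) (inv_mem hy)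

theorem IsCentricIn.mem_of_commutator (hc : IsCentricIn E) {x : S} (hx : ∀ y ∈ E, ⁅x, y⁆ = 1) :
    x ∈ E :=
  hc.mem fun y hy => (commutatorElement_eq_one_iff_mul_comm.1 (hx y hy)).symm

theorem isCharIn_centerIn : IsCharIn E (centerIn E) :=
  IsCharIn.of_commutator (IsCharIn.top E) (IsCharIn.bot E) fun y hy => by
    rw [mem_centerIn]
    simp only [hy, true_and, Subgroup.mem_top, true_imp_iff, Subgroup.mem_bot,
      commutatorElement_eq_one_iff_mul_comm, eq_comm]

theorem IsCentricIn.Zc_one_le (hc : IsCentricIn E) : Zc S 1 ≤ E := fun x hx =>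
  hc.mem fun y _ => by
    rw [Zc, Subgroup.upperCentralSeries_one] at hx
    exact Subgroup.mem_center_iff.1 hx y

theorem commutator_of_mem_center {x : S} (hx : x ∈ Zc S 1) (y : S) : ⁅x, y⁆ = 1 := by
  rw [Zc, Subgroup.upperCentralSeries_one, Subgroup.mem_center_iff] at hx
  exact commutatorElement_eq_one_iff_mul_comm.2 (hx y).symm

theorem commutator_of_mem_center' {x : S} (hx : x ∈ Zc S 1) (y : S) : ⁅y, x⁆ = 1 := by
  rw [← commutatorElement_inv, commutator_of_mem_center hx, inv_one]

end Prelim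

section Powers

variable {K S : Type*} [Field K] [Group S] (e : S ≃* UnipG2 K) {p : ℕ} [Fact p.Prime] [CharP K p]
  (hp : 5 ≤ p)
include hp

omit [Fact p.Prime] in
theorem natCast_ne_zero {m : ℕ} (hm : 0 < m) (hmp : m < 5) : (m : K) ≠ 0 := by
  rw [Ne, CharP.cast_eq_zero_iff K p]
  exact fun h => absurd (Nat.le_of_dvd hm h) (by omega)

omit [Fact p.Prime] in
theorem two_ne_zero_of_five_le : (2 : K) ≠ 0 := by
  exact_mod_cast natCast_ne_zero (K := K) hp (m := 2) (by norm_num) (by norm_num)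

omit [Fact p.Prime] in
theorem three_ne_zero_of_five_le : (3 : K) ≠ 0 := by
  exact_mod_cast natCast_ne_zero (K := K) hp (m := 3) (by norm_num) (by norm_num)

theorem seven_le_of_ne_five (h : p ≠ 5) : 7 ≤ p := by
  have h6 : p ≠ 6 := by
    rintro rfl
    exact absurd (Fact.out : Nat.Prime 6) (by norm_num)
  omega

theorem sixty_ne_zero (h : p ≠ 5) : (60 : K) ≠ 0 := by
  have h7 := seven_le_of_ne_five hp h
  have : ((60 : ℕ) : K) ≠ 0 := by
    rw [Ne, CharP.cast_eq_zero_iff K p, show 60 = 2 * 2 * 3 * 5 by norm_num]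
    simp only [(Fact.out : p.Prime).dvd_mul, not_or]
    refine ⟨⟨⟨?_, ?_⟩, ?_⟩, ?_⟩ <;> exact fun h => absurd (Nat.le_of_dvd (by norm_num) h) (by omega)
  exact_mod_cast this

include e

theorem pow_eq_one_of_ne_five (h : p ≠ 5) (x : S) : x ^ p = 1 := by
  apply e.injective
  rw [map_pow, map_one]
  exact UnipG2.pow_eq_one_of_natCast (CharP.cast_eq_zero K p) (sixty_ne_zero hp h) _

theorem pow_eq_one_of_mul_eq_zero {x : S} (h : (e x).t * (e x).v₀ = 0) : x ^ p = 1 := by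
  by_cases h5 : p = 5
  · subst h5
    apply e.injective
    have h5 : (5 : K) = 0 := by exact_mod_cast CharP.cast_eq_zero K 5
    rw [map_pow, map_one, UnipG2.pow_five h5]
    ext <;> simp
    rcases mul_eq_zero.1 h with h | h <;> simp [h]
  · exact pow_eq_one_of_ne_five e hp h5 x

theorem pow_mem_Zc_one (x : S) : x ^ p ∈ Zc S 1 := by
  have h2 := two_ne_zero_of_five_le (K := K) hp
  have h3 := three_ne_zero_of_five_le (K := K) hp
  by_cases h5 : p = 5
  · subst h5
    have h5 : (5 : K) = 0 := by exact_mod_cast CharP.cast_eq_zero K 5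
    rw [mem_Zc_one e h2 h3, map_pow, UnipG2.pow_five h5]
    simp
  · rw [pow_eq_one_of_ne_five e hp h5]
    exact one_mem _

end Powers

/-! ### Centric radical subgroups of `Q₁` -/

section Heisenberg

variable {K S : Type*} [Field K] [Group S] (e : S ≃* UnipG2 K)

/-- The symplectic form on cubic forms, evaluated at the coordinates of two elements of `S`. -/
def symp (x y : S) : K :=
  (e x).v₀ * (e y).v₃ - 3 * (e x).v₁ * (e y).v₂ + 3 * (e x).v₂ * (e y).v₁ - (e x).v₃ * (e y).v₀

theorem e_commutator_of_t {x y : S} (hx : (e x).t = 0) (hy : (e y).t = 0) :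
    e ⁅x, y⁆ = ⟨0, 0, 0, 0, 0, 2 * symp e x y⟩ := by
  rw [commutatorElement_def]
  ext <;> simp [hx, hy, symp]
  ring

theorem commutator_eq_one_iff_symp (h2 : (2 : K) ≠ 0) {x y : S} (hx : (e x).t = 0)
    (hy : (e y).t = 0) : ⁅x, y⁆ = 1 ↔ symp e x y = 0 := by
  rw [← e.injective.eq_iff, e_commutator_of_t e hx hy, map_one, UnipG2.ext_iff]
  simp [h2]

/-- The scalar multiple of the cubic form of `x`, with vanishing `z`-coordinate. -/
def vsmul (c : K) (x : S) : S :=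
  e.symm ⟨0, c * (e x).v₀, c * (e x).v₁, c * (e x).v₂, c * (e x).v₃, 0⟩

theorem symp_vsmul (c : K) (x y : S) : symp e (vsmul e c x) y = c * symp e x y := by
  simp only [symp, vsmul, MulEquiv.apply_symm_apply]
  ring

theorem vsmul_t (c : K) (x : S) : (e (vsmul e c x)).t = 0 := by simp [vsmul]

variable {p : ℕ} [Fact p.Prime] {E : Subgroup S}

include e

/-- A non-abelian centric radical subgroup of `Q₁` is `Q₁`. Elements of `Q₁` centralizing `Z(E)`
stabilize the chain `1 ≤ Z(E) ≤ E`; they include all scalar multiples of elements of `E`, so that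
`Z(S)` is the set of commutators of `E`, and `Q₁` stabilizes the chain `1 ≤ Z(S) ≤ E`. -/
theorem eq_Q1_of_not_abelian [Finite S] (hS : IsPGroup p S) (h2 : (2 : K) ≠ 0) (h3 : (3 : K) ≠ 0)
    (hc : IsCentricIn E) (hr : IsRadicalIn p E) (hE : E ≤ Q1 S) {a b : S} (ha : a ∈ E)
    (hb : b ∈ E) (hab : ⁅a, b⁆ ≠ 1) : E = Q1 S := by
  have ht : ∀ x ∈ E, (e x).t = 0 := fun x hx => (mem_Q1 e h2 h3).1 (hE hx)
  have hcomm : ∀ x y : S, (e x).t = 0 → (e y).t = 0 → ⁅x, y⁆ ∈ Zc S 1 := fun x y hx hy => by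
    rw [mem_Zc_one e h2 h3, e_commutator_of_t e hx hy]
    simp
  have hnorm : ∀ x : S, (e x).t = 0 → x ∈ Subgroup.normalizer (E : Set S) := fun x hx =>
    mem_normalizer_of_commutator fun y hy => hc.Zc_one_le (hcomm x y hx (ht y hy))
  have step1 : ∀ x : S, (e x).t = 0 → (∀ y ∈ centerIn E, ⁅x, y⁆ = 1) → x ∈ E := fun x hx hxc =>
    hr.mem_of_chain_one hS hc isCharIn_centerIn (hnorm x hx)
      (fun y hy => mem_centerIn.2 ⟨hc.Zc_one_le (hcomm x y hx (ht y hy)), fun u _ =>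
        commutatorElement_eq_one_iff_mul_comm.1
          (commutator_of_mem_center' (hcomm x y hx (ht y hy)) u)⟩)
      (fun y _ hyc => hxc y hyc)
  have step2 : ∀ (c : K), ∀ x ∈ E, vsmul e c x ∈ E := fun c x hx =>
    step1 _ (vsmul_t e c x) fun y hy => by
      obtain ⟨hyE, hyc⟩ := mem_centerIn.1 hy
      rw [commutator_eq_one_iff_symp e h2 (vsmul_t e c x) (ht y hyE), symp_vsmul,
        (commutator_eq_one_iff_symp e h2 (ht x hx) (ht y hyE)).1
          (commutatorElement_eq_one_iff_mul_comm.2 (hyc x hx)), mul_zero]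
  have hab' : symp e a b ≠ 0 := fun h =>
    hab ((commutator_eq_one_iff_symp e h2 (ht a ha) (ht b hb)).2 h)
  have hchar : IsCharIn E (Zc S 1) := IsCharIn.of_eq_commutators fun y hy => by
    constructor
    · intro hy1
      refine ⟨vsmul e ((e y).z / (2 * symp e a b)) a, step2 _ a ha, b, hb, e.injective ?_⟩
      rw [e_commutator_of_t e (vsmul_t e _ a) (ht b hb), symp_vsmul]
      obtain ⟨h1, h2', h3', h4, h5⟩ := (mem_Zc_one e h2 h3).1 hy1
      ext <;> simp [*]
      field_simp
    · rintro ⟨c, hc, d, hd, rfl⟩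
      exact hcomm c d (ht c hc) (ht d hd)
  refine le_antisymm hE fun x hx => ?_
  rw [mem_Q1 e h2 h3] at hx
  exact hr.mem_of_chain_one hS hc hchar (hnorm x hx) (fun y hy => hcomm x y hx (ht y hy))
    (fun y _ hy => commutator_of_mem_center' hy x)

end Heisenberg

section Lagrangian

/-- The invariant symplectic form on binary cubic forms. -/
def cubicForm (K : Type*) [Field K] : LinearMap.BilinForm K (Fin 4 → K) :=
  LinearMap.mk₂ K (fun v w => v 0 * w 3 - 3 * v 1 * w 2 + 3 * v 2 * w 1 - v 3 * w 0)
    (fun _ _ _ => by simp only [Pi.add_apply]; ring)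
    (fun _ _ _ => by simp only [Pi.smul_apply, smul_eq_mul]; ring)
    (fun _ _ _ => by simp only [Pi.add_apply]; ring)
    (fun _ _ _ => by simp only [Pi.smul_apply, smul_eq_mul]; ring)

theorem cubicForm_apply {K : Type*} [Field K] (v w : Fin 4 → K) :
    cubicForm K v w = v 0 * w 3 - 3 * v 1 * w 2 + 3 * v 2 * w 1 - v 3 * w 0 := rfl

theorem cubicForm_nondegenerate {K : Type*} [Field K] (h3 : (3 : K) ≠ 0) :
    (cubicForm K).Nondegenerate := by
  constructor
  · intro v hv
    have a0 := hv ![1, 0, 0, 0]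
    have a1 := hv ![0, 1, 0, 0]
    have a2 := hv ![0, 0, 1, 0]
    have a3 := hv ![0, 0, 0, 1]
    simp [cubicForm_apply, h3] at a0 a1 a2 a3
    funext i
    fin_cases i <;> simp [a0, a1, a2, a3]
  · intro v hv
    have a0 := hv ![1, 0, 0, 0]
    have a1 := hv ![0, 1, 0, 0]
    have a2 := hv ![0, 0, 1, 0]
    have a3 := hv ![0, 0, 0, 1]
    simp [cubicForm_apply, h3] at a0 a1 a2 a3
    funext i
    fin_cases i <;> simp [a0, a1, a2, a3]

variable {K S : Type*} [Field K] [Group S] (e : S ≃* UnipG2 K) {E : Subgroup S}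
include e

/-- The image in the space of cubic forms of an abelian centric subgroup `E` of `Q₁` is its own
orthogonal space. -/
theorem mem_iff_of_abelian (h2 : (2 : K) ≠ 0) (h3 : (3 : K) ≠ 0) (hc : IsCentricIn E)
    (hE : E ≤ Q1 S) (hab : ∀ a ∈ E, ∀ b ∈ E, ⁅a, b⁆ = 1) (x : S) :
    x ∈ E ↔ (e x).t = 0 ∧ ∀ y ∈ E, symp e x y = 0 := by
  have ht : ∀ x ∈ E, (e x).t = 0 := fun x hx => (mem_Q1 e h2 h3).1 (hE hx)
  constructor
  · exact fun hx => ⟨ht x hx, fun y hy =>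
      (commutator_eq_one_iff_symp e h2 (ht x hx) (ht y hy)).1 (hab x hx y hy)⟩
  · exact fun ⟨hx, h⟩ => hc.mem_of_commutator fun y hy =>
      (commutator_eq_one_iff_symp e h2 hx (ht y hy)).2 (h y hy)

theorem card_of_abelian [Finite K] (h2 : (2 : K) ≠ 0) (h3 : (3 : K) ≠ 0) (hc : IsCentricIn E)
    (hE : E ≤ Q1 S) (hab : ∀ a ∈ E, ∀ b ∈ E, ⁅a, b⁆ = 1) : Nat.card E = Nat.card K ^ 3 := by
  have hmem := mem_iff_of_abelian e h2 h3 hc hE hab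
  let vec : S → Fin 4 → K := fun x => ![(e x).v₀, (e x).v₁, (e x).v₂, (e x).v₃]
  have hsymp : ∀ x y, symp e x y = cubicForm K (vec x) (vec y) := fun x y => by
    simp [symp, cubicForm_apply, vec]
  let R : Submodule K (Fin 4 → K) :=
    { carrier := {v | ∀ y ∈ E, cubicForm K v (vec y) = 0}
      zero_mem' := fun y _ => by simp
      add_mem' := fun {v w} hv hw y hy => by simp [hv y hy, hw y hy]
      smul_mem' := fun c v hv y hy => by simp [hv y hy] }
  have hR : ∀ v, v ∈ R ↔ ∀ y ∈ E, cubicForm K v (vec y) = 0 := fun v => Iff.rfl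
  let lift : (Fin 4 → K) → K → UnipG2 K := fun v z => ⟨0, v 0, v 1, v 2, v 3, z⟩
  have hvl : ∀ v z, vec (e.symm (lift v z)) = v := fun v z => by
    funext i
    fin_cases i <;> simp [vec, lift]
  have hlift : ∀ v z, v ∈ R ↔ e.symm (lift v z) ∈ E := fun v z => by
    rw [hmem, hR]
    simp only [hsymp, hvl]
    simp [lift]
  have hvR : ∀ x ∈ E, vec x ∈ R := fun x hx y hy => by
    rw [← hsymp]; exact ((hmem x).1 hx).2 y hy
  have horth : (cubicForm K).orthogonal R = R := by
    ext w
    rw [LinearMap.BilinForm.mem_orthogonal_iff]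
    constructor
    · intro h y hy
      have h1 : cubicForm K (vec y) w = 0 := h _ (hvR y hy)
      rw [cubicForm_apply] at h1 ⊢
      linear_combination -h1
    · intro hw v hv
      have h1 := hv _ ((hlift w 0).1 hw)
      rwa [hvl] at h1
  have hfin : Module.finrank K R = 2 := by
    have h1 := LinearMap.BilinForm.finrank_orthogonal (cubicForm_nondegenerate h3) R
    have h4 := Submodule.finrank_le R
    rw [horth] at h1
    rw [Module.finrank_fin_fun] at h1 h4
    omega
  rw [card_eq_of_param e E (fun a : R × K => lift a.1 a.2), Nat.card_prod,
    Module.natCard_eq_pow_finrank (K := K) (V := R), hfin]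
  · ring
  · rintro ⟨⟨v, hv⟩, z⟩ ⟨⟨w, hw⟩, z'⟩ h
    have h0 : vec (e.symm (lift v z)) = vec (e.symm (lift w z')) :=
      congrArg (fun u => vec (e.symm u)) h
    rw [hvl, hvl] at h0
    subst h0
    have hz : z = z' := congrArg UnipG2.z h
    subst hz
    rfl
  · intro x
    constructor
    · intro hx
      refine ⟨(⟨vec x, hvR x hx⟩, (e x).z), ?_⟩
      ext <;> simp [lift, vec, ((hmem x).1 hx).1]
    · rintro ⟨⟨⟨v, hv⟩, z⟩, h⟩
      have := (hlift v z).1 hv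
      rwa [show lift v z = e x from h, MulEquiv.symm_apply_apply] at this

/-- An abelian centric subgroup `E ≠ Z₃(S)` of `Q₁` has normalizer `Q₁`: an element outside `Q₁`
translates the cubic forms in `E`, and a translate of a form has to be orthogonal to the form. -/
theorem normalizer_of_abelian [Finite S] (h2 : (2 : K) ≠ 0) (h3 : (3 : K) ≠ 0) (hc : IsCentricIn E)
    (hE : E ≤ Q1 S) (hab : ∀ a ∈ E, ∀ b ∈ E, ⁅a, b⁆ = 1) (hne : E ≠ Zc S 3) :
    Subgroup.normalizer (E : Set S) = Q1 S := by
  have hmem := mem_iff_of_abelian e h2 h3 hc hE hab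
  apply le_antisymm
  · intro g hg
    rw [mem_Q1 e h2 h3]
    by_contra hs
    have key : ∀ g ∈ Subgroup.normalizer (E : Set S), ∀ x ∈ E,
        6 * (e g).t * ((e x).v₀ * (e x).v₂ - (e x).v₁ ^ 2) + (e g).t ^ 3 * (e x).v₀ ^ 2 = 0 := by
      intro g hg x hx
      have hx' := (Subgroup.mem_normalizer_iff''.1 hg x).1 hx
      have h := ((hmem x).1 hx).2 _ hx'
      have ht := ((hmem x).1 hx).1
      simp only [symp, map_mul, map_inv, UnipG2.mul_v₃, UnipG2.mul_v₂, UnipG2.mul_v₁,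
        UnipG2.mul_v₀, UnipG2.inv_v₃, UnipG2.inv_v₂, UnipG2.inv_v₁, UnipG2.inv_v₀, ht] at h
      linear_combination h
    have hv0 : ∀ x ∈ E, (e x).v₀ = 0 := by
      intro x hx
      have k1 := key g hg x hx
      have k2 := key (g ^ 2) (pow_mem hg 2) x hx
      have ht2 : (e (g ^ 2)).t = 2 * (e g).t := by rw [pow_two, map_mul, UnipG2.mul_t]; ring
      rw [ht2] at k2
      have : 2 * 3 * (e g).t ^ 3 * (e x).v₀ ^ 2 = 0 := by linear_combination k2 - 2 * k1
      simpa [h2, h3, hs] using this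
    have hv1 : ∀ x ∈ E, (e x).v₁ = 0 := by
      intro x hx
      have k1 := key g hg x hx
      rw [hv0 x hx] at k1
      have : 2 * 3 * (e g).t * (e x).v₁ ^ 2 = 0 := by linear_combination -k1
      simpa [h2, h3, hs] using this
    refine hne (le_antisymm (fun x hx => ?_) fun x hx => ?_)
    · rw [mem_Zc_three e h2 h3]
      exact ⟨((hmem x).1 hx).1, hv0 x hx, hv1 x hx⟩
    · obtain ⟨a1, a2, a3⟩ := (mem_Zc_three e h2 h3).1 hx
      refine (hmem x).2 ⟨a1, fun y hy => ?_⟩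
      simp [symp, a2, a3, hv0 y hy, hv1 y hy]
  · intro g hg
    rw [mem_Q1 e h2 h3] at hg
    refine mem_normalizer_of_commutator fun y hy => hc.Zc_one_le ?_
    rw [mem_Zc_one e h2 h3, e_commutator_of_t e hg ((hmem y).1 hy).1]
    simp

theorem inf_Zc_two_of_abelian (h2 : (2 : K) ≠ 0) (h3 : (3 : K) ≠ 0) (hc : IsCentricIn E)
    (hE : E ≤ Q1 S) (hab : ∀ a ∈ E, ∀ b ∈ E, ⁅a, b⁆ = 1) (hne : ¬ E ≤ commutator S) :
    E ⊓ Zc S 2 = Subgroup.center S := by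
  have hmem := mem_iff_of_abelian e h2 h3 hc hE hab
  rw [← Subgroup.upperCentralSeries_one]
  apply le_antisymm
  · rintro x ⟨hx, hx2⟩
    obtain ⟨y, hy, hyn⟩ := Set.not_subset.1 hne
    have hy0 : (e y).v₀ ≠ 0 := fun h =>
      hyn ((mem_commutator_iff e h2 h3).2 ⟨((hmem y).1 hy).1, h⟩)
    obtain ⟨a1, a2, a3, a4⟩ := (mem_Zc_two e h2 h3).1 hx2
    have h := ((hmem x).1 hx).2 y hy
    simp only [symp, a2, a3, a4] at h
    exact (mem_Zc_one e h2 h3).2 ⟨a1, a2, a3, a4, by simpa [hy0] using h⟩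
  · refine le_inf hc.Zc_one_le fun x hx => ?_
    obtain ⟨a1, a2, a3, a4, -⟩ := (mem_Zc_one e h2 h3).1 hx
    exact (mem_Zc_two e h2 h3).2 ⟨a1, a2, a3, a4⟩

end Lagrangian

/-! ### Centric radical subgroups of `Q₂` -/

section InQ2

section

variable {S : Type*} [Group S] {E : Subgroup S}

theorem commutator_of_mem_Q2 {x y : S} (hx : x ∈ Zc S 2) (hy : y ∈ Q2 S) : ⁅y, x⁆ = 1 :=
  commutatorElement_eq_one_iff_mul_comm.2 (Subgroup.mem_centralizer_iff.1 hy x hx).symm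

theorem commutator_of_mem_Q2' {x y : S} (hx : x ∈ Zc S 2) (hy : y ∈ Q2 S) : ⁅x, y⁆ = 1 :=
  commutatorElement_eq_one_iff_mul_comm.2 (Subgroup.mem_centralizer_iff.1 hy x hx)

theorem Zc_two_le_of_le_Q2 (hc : IsCentricIn E) (hE : E ≤ Q2 S) : Zc S 2 ≤ E := fun _ hx =>
  hc.mem_of_commutator fun _ hy => commutator_of_mem_Q2' hx (hE hy)

end

variable {K S : Type*} [Field K] [Group S] (e : S ≃* UnipG2 K) {E : Subgroup S}
include e

theorem exists_conj_coord_Q2 (h2 : (2 : K) ≠ 0) {x : S} (ht : (e x).t ≠ 0) (hv : (e x).v₀ = 0) :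
    ∃ e' : S ≃* UnipG2 K, (e' x).t ≠ 0 ∧ (e' x).v₁ = 0 ∧ (e' x).v₂ = 0 := by
  refine ⟨e.trans (MulAut.conj ⟨0, -(e x).v₁ / (e x).t,
    -((e x).v₂ + -(e x).v₁ / (e x).t * (e x).t ^ 2) / (2 * (e x).t), 0, 0, 0⟩), ?_, ?_, ?_⟩ <;>
  simp [MulAut.conj_apply, hv]
  · exact ht
  · field_simp
    ring
  · field_simp
    ring

section

variable (h2 : (2 : K) ≠ 0) (h3 : (3 : K) ≠ 0)
include h2 h3

theorem commutator_mem_Zc_two_of_Q2 {x y : S} (hx : (e x).v₀ = 0) (hy : (e y).v₀ = 0) :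
    ⁅x, y⁆ ∈ Zc S 2 ↔ (e y).t * (e x).v₁ = (e x).t * (e y).v₁ := by
  rw [commutator_mem_Zc_two_iff e h2 h3, hx, hy]
  constructor
  · rintro ⟨-, h⟩
    exact mul_left_cancel₀ h2 (by linear_combination h)
  · exact fun h => ⟨by ring, by linear_combination 2 * h⟩

omit h2 in
theorem t_mul_v₂_of_commutator {x y : S} (hx0 : (e x).v₀ = 0) (hx1 : (e x).v₁ = 0)
    (hy0 : (e y).v₀ = 0) (hy1 : (e y).v₁ = 0) (h : ⁅y, x⁆ = 1) :
    (e y).t * (e x).v₂ = (e x).t * (e y).v₂ := by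
  have h := ((commutator_eq_one_iff e y x).1 h).2.2.1
  rw [hx0, hx1, hy0, hy1] at h
  exact mul_left_cancel₀ h3 (by linear_combination -h)

variable [Finite S] {p : ℕ} [Fact p.Prime]

/-- If the image of `E ≤ Q₂` in `Q₂/Z₃(S)` is not contained in a line, then `Z₂(S) = Z(E)` and
`Z₃(S)` is the second centre of `E`, and `Q₂` stabilizes the chain `1 ≤ Z₂(S) ≤ Z₃(S) ≤ E`. -/
theorem eq_Q2_of_not_line (hS : IsPGroup p S) (hc : IsCentricIn E) (hr : IsRadicalIn p E)
    (hE : E ≤ Q2 S) {x : S} (hx : x ∈ E) (hxt : (e x).t ≠ 0) (hx1 : (e x).v₁ = 0)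
    {g : S} (hg : g ∈ E) (hg1 : (e g).v₁ ≠ 0) : E = Q2 S := by
  have hv : ∀ x ∈ E, (e x).v₀ = 0 := fun x hx => (mem_Q2 e h2 h3).1 (hE hx)
  have hZ2 := Zc_two_le_of_le_Q2 hc hE
  have hZ3 : ∀ y ∈ E, y ∈ Zc S 3 ↔ ∀ u ∈ E, ⁅y, u⁆ ∈ Zc S 2 := by
    intro y hy
    constructor
    · exact fun h u _ => Subgroup.mem_upperCentralSeries_succ_iff.1 h u
    · intro h
      have a1 := (commutator_mem_Zc_two_of_Q2 e h2 h3 (hv y hy) (hv x hx)).1 (h x hx)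
      have a2 := (commutator_mem_Zc_two_of_Q2 e h2 h3 (hv y hy) (hv g hg)).1 (h g hg)
      have y1 : (e y).v₁ = 0 := by simpa [hx1, hxt] using a1
      have y2 : (e y).t = 0 := by simpa [y1, hg1, eq_comm] using a2
      exact (mem_Zc_three e h2 h3).2 ⟨y2, hv y hy, y1⟩
  have hchar2 : IsCharIn E (Zc S 2) :=
    IsCharIn.of_commutator (IsCharIn.top E) (IsCharIn.bot E) fun y hy => by
      constructor
      · exact fun h u hu _ => Subgroup.mem_bot.2 (commutator_of_mem_Q2' h (hE hu))
      · intro h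
        have h' : ∀ u ∈ E, ⁅y, u⁆ = 1 := fun u hu =>
          Subgroup.mem_bot.1 (h u hu (Subgroup.mem_top u))
        obtain ⟨y1, y2, y3⟩ := (mem_Zc_three e h2 h3).1 ((hZ3 y hy).2 fun u hu => by
          rw [h' u hu]; exact one_mem _)
        have := t_mul_v₂_of_commutator e h3 (hv x hx) hx1 y2 y3 (h' x hx)
        rw [y1, zero_mul, eq_comm] at this
        exact (mem_Zc_two e h2 h3).2 ⟨y1, y2, y3, by simpa [hxt] using this⟩
  have hZ3E : Zc S 3 ≤ E := fun y hy =>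
    have h1 : ∀ u ∈ E, ⁅y, u⁆ ∈ Zc S 2 := fun u _ => Subgroup.mem_upperCentralSeries_succ_iff.1 hy u
    hr.mem_of_chain_one hS hc hchar2 (mem_normalizer_of_commutator fun u hu => hZ2 (h1 u hu)) h1
      fun u _ hu2 => commutator_of_mem_Q2 hu2
        ((mem_Q2 e h2 h3).2 ((mem_Zc_three e h2 h3).1 hy).2.1)
  have hchar3 : IsCharIn E (Zc S 3) :=
    IsCharIn.of_commutator (IsCharIn.top E) hchar2 fun y hy => by
      simpa using hZ3 y hy
  refine le_antisymm hE fun y hy => ?_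
  have hy0 := (mem_Q2 e h2 h3).1 hy
  have h1 : ∀ u ∈ E, ⁅y, u⁆ ∈ Zc S 3 := fun u hu => by
    rw [commutator_mem_Zc_three_iff e h2 h3, hy0, hv u hu]; ring
  refine hr.mem_of_chain_two hS hc hchar2 hchar3
    (mem_normalizer_of_commutator fun u hu => hZ3E (h1 u hu)) h1 (fun u hu hu3 => ?_)
    fun u _ hu2 => commutator_of_mem_Q2 hu2 hy
  rw [← commutatorElement_inv]
  exact inv_mem (Subgroup.mem_upperCentralSeries_succ_iff.1 hu3 y)

omit h2 h3 [Finite S] in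
/-- The normalizer of a subgroup of `Q₂` containing the root subgroup of `α`, whose elements have
`v₁ = 0`, is contained in `Q₂`. -/
theorem v₀_of_mem_normalizer (hu : e.symm ⟨1, 0, 0, 0, 0, 0⟩ ∈ E)
    (hv1 : ∀ y ∈ E, (e y).v₁ = 0) {g : S} (hg : g ∈ Subgroup.normalizer (E : Set S)) :
    (e g).v₀ = 0 := by
  have h1 := (commutator_v₁_eq_zero_iff e _ _).1
    (hv1 _ (commutator_mem_of_mem_normalizer hg hu))
  simp only [MulEquiv.apply_symm_apply] at h1
  linear_combination h1

/-- The abelian centric subgroups of `Q₂` outside `Q₁`, up to conjugation. -/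
theorem abelian_in_Q2 (hc : IsCentricIn E) (hE : E ≤ Q2 S) {x : S} (hx : x ∈ E)
    (hxt : (e x).t ≠ 0) (hx2 : (e x).v₂ = 0) (hv1 : ∀ y ∈ E, (e y).v₁ = 0)
    (hab : ∀ a ∈ E, ∀ b ∈ E, ⁅a, b⁆ = 1) :
    Nat.card E = Nat.card K ^ 3 ∧ Subgroup.normalizer (E : Set S) = E ⊔ Zc S 3 ∧
      Nat.card (Subgroup.normalizer (E : Set S)) = Nat.card K ^ 4 := by
  have hv : ∀ x ∈ E, (e x).v₀ = 0 := fun x hx => (mem_Q2 e h2 h3).1 (hE hx)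
  have hZ2 := Zc_two_le_of_le_Q2 hc hE
  have hv2 : ∀ y ∈ E, (e y).v₂ = 0 := fun y hy => by
    have := t_mul_v₂_of_commutator e h3 (hv x hx) (hv1 x hx) (hv y hy) (hv1 y hy) (hab y hy x hx)
    rw [hx2, mul_zero, eq_comm] at this
    simpa [hxt] using this
  have hmem : ∀ y, y ∈ E ↔ (e y).v₀ = 0 ∧ (e y).v₁ = 0 ∧ (e y).v₂ = 0 := by
    intro y
    constructor
    · exact fun hy => ⟨hv y hy, hv1 y hy, hv2 y hy⟩
    · rintro ⟨y0, y1, y2⟩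
      refine hc.mem_of_commutator fun u hu => (commutator_eq_one_iff e y u).2 ?_
      simp only [map_mul, UnipG2.mul_z, y0, y1, y2, hv u hu, hv1 u hu, hv2 u hu]
      refine ⟨?_, ?_, ?_, ?_⟩ <;> ring
  have hu : e.symm ⟨1, 0, 0, 0, 0, 0⟩ ∈ E := (hmem _).2 (by simp)
  have hN : ∀ g, g ∈ Subgroup.normalizer (E : Set S) ↔ (e g).v₀ = 0 ∧ (e g).v₁ = 0 := by
    intro g
    constructor
    · intro hg
      have h0 := v₀_of_mem_normalizer e hu hv1 hg
      have hm := commutator_mem_of_mem_normalizer hg hu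
      have h1 := (commutator_v₂_eq_zero_iff e _ _
        ((commutator_v₁_eq_zero_iff e _ _).1 (hv1 _ hm))).1 (hv2 _ hm)
      simp only [MulEquiv.apply_symm_apply, h0] at h1
      exact ⟨h0, mul_left_cancel₀ h2 (by linear_combination h1)⟩
    · rintro ⟨g0, g1⟩
      refine mem_normalizer_of_commutator fun y hy => hZ2 ?_
      rw [commutator_mem_Zc_two_of_Q2 e h2 h3 g0 (hv y hy), g1, hv1 y hy]
      ring
  refine ⟨?_, le_antisymm (fun g hg => ?_) (sup_le Subgroup.le_normalizer fun g hg => ?_), ?_⟩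
  · rw [card_eq_of_param e E (fun a : K × K × K => ⟨a.1, 0, 0, 0, a.2.1, a.2.2⟩), Nat.card_prod,
      Nat.card_prod]
    · ring
    · rintro ⟨a, b, c⟩ ⟨a', b', c'⟩ h
      simpa using h
    · intro y
      rw [hmem]
      constructor
      · rintro ⟨y0, y1, y2⟩
        exact ⟨((e y).t, (e y).v₃, (e y).z), by ext <;> simp [y0, y1, y2]⟩
      · rintro ⟨a, ha⟩
        simp [← ha]
  · obtain ⟨g0, g1⟩ := (hN g).1 hg
    have ha : e.symm ⟨(e g).t, 0, 0, 0, 0, 0⟩ ∈ E := (hmem _).2 (by simp)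
    rw [← mul_inv_cancel_left (e.symm ⟨(e g).t, 0, 0, 0, 0, 0⟩) g]
    refine mul_mem (Subgroup.mem_sup_left ha) (Subgroup.mem_sup_right ?_)
    rw [mem_Zc_three e h2 h3]
    simp [g0, g1]
  · obtain ⟨-, g0, g1⟩ := (mem_Zc_three e h2 h3).1 hg
    exact (hN g).2 ⟨g0, g1⟩
  · rw [card_eq_of_param e _ (fun a : K × K × K × K => ⟨a.1, 0, 0, a.2.1, a.2.2.1, a.2.2.2⟩),
      Nat.card_prod, Nat.card_prod, Nat.card_prod]
    · ring
    · rintro ⟨a, b, c, d⟩ ⟨a', b', c', d'⟩ h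
      simpa using h
    · intro y
      rw [hN]
      constructor
      · rintro ⟨y0, y1⟩
        exact ⟨((e y).t, (e y).v₂, (e y).v₃, (e y).z), by ext <;> simp [y0, y1]⟩
      · rintro ⟨a, ha⟩
        simp [← ha]

/-- A non-abelian subgroup of `Q₂` with image in `Q₂/Z₃(S)` contained in a line different from
`S'/Z₃(S)` is the preimage of that line, up to conjugation the group `v₀ = v₁ = 0`. -/
theorem mem_iff_of_line (hS : IsPGroup p S) (hc : IsCentricIn E) (hr : IsRadicalIn p E)
    (hE : E ≤ Q2 S) {x : S} (hx : x ∈ E) (hxt : (e x).t ≠ 0) (hx2 : (e x).v₂ = 0)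
    (hv1 : ∀ y ∈ E, (e y).v₁ = 0) (hab : ¬ ∀ a ∈ E, ∀ b ∈ E, ⁅a, b⁆ = 1) (y : S) :
    y ∈ E ↔ (e y).v₀ = 0 ∧ (e y).v₁ = 0 := by
  have hv : ∀ x ∈ E, (e x).v₀ = 0 := fun x hx => (mem_Q2 e h2 h3).1 (hE hx)
  have hZ2 := Zc_two_le_of_le_Q2 hc hE
  obtain ⟨a, ha, ha2⟩ : ∃ a ∈ E, (e a).v₂ ≠ 0 := by
    by_contra! h
    refine hab fun a ha b hb => (commutator_eq_one_iff e a b).2 ?_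
    simp only [map_mul, UnipG2.mul_z, hv a ha, hv1 a ha, h a ha, hv b hb, hv1 b hb, h b hb]
    refine ⟨?_, ?_, ?_, ?_⟩ <;> ring
  refine ⟨fun hy => ⟨hv y hy, hv1 y hy⟩, fun ⟨y0, y1⟩ => ?_⟩
  have hchar2 : IsCharIn E (Zc S 2) :=
    IsCharIn.of_commutator (IsCharIn.top E) (IsCharIn.bot E) fun u hu => by
      constructor
      · exact fun h w hw _ => Subgroup.mem_bot.2 (commutator_of_mem_Q2' h (hE hw))
      · intro h
        have b1 := t_mul_v₂_of_commutator e h3 (hv x hx) (hv1 x hx) (hv u hu) (hv1 u hu)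
          (Subgroup.mem_bot.1 (h x hx (Subgroup.mem_top x)))
        have b2 := t_mul_v₂_of_commutator e h3 (hv a ha) (hv1 a ha) (hv u hu) (hv1 u hu)
          (Subgroup.mem_bot.1 (h a ha (Subgroup.mem_top a)))
        have u2 : (e u).v₂ = 0 := by simpa [hx2, hxt, eq_comm] using b1
        have ut : (e u).t = 0 := by simpa [u2, ha2] using b2
        exact (mem_Zc_two e h2 h3).2 ⟨ut, hv u hu, hv1 u hu, u2⟩
  have h1 : ∀ u ∈ E, ⁅y, u⁆ ∈ Zc S 2 := fun u hu => by
    rw [commutator_mem_Zc_two_of_Q2 e h2 h3 y0 (hv u hu), y1, hv1 u hu]; ring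
  exact hr.mem_of_chain_one hS hc hchar2 (mem_normalizer_of_commutator fun u hu => hZ2 (h1 u hu)) h1
    fun u _ hu2 => commutator_of_mem_Q2 hu2 ((mem_Q2 e h2 h3).2 y0)

omit h2 h3 [Finite S] in
/-- The root subgroup of `3α + β`. -/
def rootSubgroupV₃ : Subgroup S where
  carrier := {x | (e x).t = 0 ∧ (e x).v₀ = 0 ∧ (e x).v₁ = 0 ∧ (e x).v₂ = 0 ∧ (e x).z = 0}
  one_mem' := by simp
  mul_mem' := by
    rintro x y ⟨h1, h2, h3, h4, h5⟩ ⟨k1, k2, k3, k4, k5⟩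
    simp [*]
  inv_mem' := by
    rintro x ⟨h1, h2, h3, h4, h5⟩
    simp [*]

theorem nonabelian_in_Q2 (hS : IsPGroup p S) (hpow : ∀ x ∈ E, x ^ p = 1)
    (hmem : ∀ y, y ∈ E ↔ (e y).v₀ = 0 ∧ (e y).v₁ = 0) :
    Nat.card E = Nat.card K ^ 4 ∧ frattiniIn E < Zc S 2 ∧ Zc S 2 = centerIn E ∧
      Nat.card (frattiniIn E) = Nat.card K ∧ Subgroup.normalizer (E : Set S) = Q2 S := by
  have hEQ : E ≤ Q2 S := fun y hy => (mem_Q2 e h2 h3).2 ((hmem y).1 hy).1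
  have hr3 : ∀ x, x ∈ rootSubgroupV₃ e ↔
      (e x).t = 0 ∧ (e x).v₀ = 0 ∧ (e x).v₁ = 0 ∧ (e x).v₂ = 0 ∧ (e x).z = 0 := fun x => Iff.rfl
  have hu : e.symm ⟨1, 0, 0, 0, 0, 0⟩ ∈ E := (hmem _).2 (by simp)
  have hw : ∀ c, e.symm ⟨0, 0, 0, c, 0, 0⟩ ∈ E := fun c => (hmem _).2 (by simp)
  have hfr : frattiniIn E = rootSubgroupV₃ e := by
    refine frattiniIn_eq hS E _ (fun y hy => ?_) (fun a ha b hb => ?_) fun a ha => ?_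
    · obtain ⟨y1, y2, y3, y4, y5⟩ := (hr3 y).1 hy
      refine ⟨_, hw ((e y).v₃ / 3), _, hu, ?_⟩
      rw [commutatorElement_def, eq_mul_inv_iff_mul_eq, eq_mul_inv_iff_mul_eq]
      apply e.injective
      ext <;> simp [y1, y2, y3, y4, y5]
      field_simp
    · obtain ⟨a0, a1⟩ := (hmem a).1 ha
      obtain ⟨b0, b1⟩ := (hmem b).1 hb
      rw [hr3, commutatorElement_def]
      simp [a0, a1, b0, b1]
    · rw [hpow a ha]
      exact one_mem _
  have hcen : Zc S 2 = centerIn E := by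
    ext y
    rw [mem_centerIn]
    constructor
    · intro hy
      obtain ⟨y1, y2, y3, y4⟩ := (mem_Zc_two e h2 h3).1 hy
      exact ⟨(hmem y).2 ⟨y2, y3⟩, fun u hu =>
        (Subgroup.mem_centralizer_iff.1 (hEQ hu) y hy).symm⟩
    · rintro ⟨hy, h⟩
      obtain ⟨y0, y1⟩ := (hmem y).1 hy
      have b1 := t_mul_v₂_of_commutator e h3 ((hmem _).1 hu).1 ((hmem _).1 hu).2 y0 y1
        (commutatorElement_eq_one_iff_mul_comm.2 (h _ hu).symm)
      have b2 := t_mul_v₂_of_commutator e h3 ((hmem _).1 (hw 1)).1 ((hmem _).1 (hw 1)).2 y0 y1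
        (commutatorElement_eq_one_iff_mul_comm.2 (h _ (hw 1)).symm)
      simp only [MulEquiv.apply_symm_apply] at b1 b2
      exact (mem_Zc_two e h2 h3).2
        ⟨by linear_combination b2, y0, y1, by linear_combination -b1⟩
  refine ⟨?_, ?_, hcen, ?_, le_antisymm (fun g hg => ?_) fun g hg => ?_⟩
  · rw [card_eq_of_param e _ (fun a : K × K × K × K => ⟨a.1, 0, 0, a.2.1, a.2.2.1, a.2.2.2⟩),
      Nat.card_prod, Nat.card_prod, Nat.card_prod]
    · ring
    · rintro ⟨a, b, c, d⟩ ⟨a', b', c', d'⟩ h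
      simpa using h
    · intro y
      rw [hmem]
      constructor
      · rintro ⟨y0, y1⟩
        exact ⟨((e y).t, (e y).v₂, (e y).v₃, (e y).z), by ext <;> simp [y0, y1]⟩
      · rintro ⟨a, ha⟩
        simp [← ha]
  · rw [hfr]
    refine lt_of_le_of_ne (fun y hy => ?_) fun h => ?_
    · obtain ⟨y1, y2, y3, y4, -⟩ := (hr3 y).1 hy
      exact (mem_Zc_two e h2 h3).2 ⟨y1, y2, y3, y4⟩
    · have h1 : e.symm ⟨0, 0, 0, 0, 0, 1⟩ ∈ Zc S 2 := (mem_Zc_two e h2 h3).2 (by simp)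
      rw [← h, hr3] at h1
      simp at h1
  · rw [hfr, card_eq_of_param e _ (fun a : K => ⟨0, 0, 0, 0, a, 0⟩)]
    · intro a a' h
      simpa using h
    · intro y
      rw [hr3]
      constructor
      · rintro ⟨y1, y2, y3, y4, y5⟩
        exact ⟨(e y).v₃, by ext <;> simp [y1, y2, y3, y4, y5]⟩
      · rintro ⟨a, ha⟩
        simp [← ha]
  · exact (mem_Q2 e h2 h3).2 (v₀_of_mem_normalizer e hu (fun y hy => ((hmem y).1 hy).2) hg)
  · refine mem_normalizer_of_commutator fun y hy => (hmem _).2 ⟨commutator_v₀ e g y, ?_⟩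
    rw [commutator_v₁_eq_zero_iff, (mem_Q2 e h2 h3).1 hg, ((hmem y).1 hy).1]
    ring

end

end InQ2

/-! ### Centric radical subgroups with regular elements -/

section Regular

theorem mem_of_isCharIn_Zc {S : Type*} [Group S] [Finite S] {p : ℕ} [Fact p.Prime]
    (hS : IsPGroup p S) {E : Subgroup S} (hc : IsCentricIn E) (hr : IsRadicalIn p E) {j : ℕ}
    (hchar : ∀ i ≤ j, IsCharIn E (Zc S i)) (hle : Zc S j ≤ E) {g : S}
    (h : ∀ y ∈ E, ⁅g, y⁆ ∈ Zc S j) : g ∈ E := by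
  refine hr.mem_of_chain hS hc (fun i => if i ≤ j then Zc S i else ⊤) (j + 1) (fun i => ?_)
    (by simp) (by simp) (mem_normalizer_of_commutator fun y hy => hle (h y hy)) ?_
  · split_ifs with hi
    exacts [hchar i hi, IsCharIn.top E]
  · intro i hi y hy hyi
    rw [if_pos (by omega : i ≤ j)]
    by_cases hij : i = j
    · exact hij ▸ h y hy
    · rw [if_pos (by omega : i + 1 ≤ j)] at hyi
      rw [← commutatorElement_inv]
      exact inv_mem (Subgroup.mem_upperCentralSeries_succ_iff.1 hyi g)

variable {K S : Type*} [Field K] [Group S] (e : S ≃* UnipG2 K) {E : Subgroup S} (h2 : (2 : K) ≠ 0)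
  (h3 : (3 : K) ≠ 0)
include e h2 h3

/-- The automorphisms of `S` induced by a Borel subgroup of `G₂(K)` are transitive on the regular
elements, those outside `Q₁` and `Q₂`. -/
theorem exists_coord_of_regular {x : S} (ht : (e x).t ≠ 0) (hv : (e x).v₀ ≠ 0) :
    ∃ e' : S ≃* UnipG2 K, e' x = ⟨1, 1, 0, 0, 0, 0⟩ := by
  obtain ⟨e₁, b1, b2⟩ : ∃ e₁ : S ≃* UnipG2 K, (e₁ x).t = 1 ∧ (e₁ x).v₀ = 1 := by
    refine ⟨e.trans (UnipG2.torus (e x).t⁻¹ (e x).v₀⁻¹ (inv_ne_zero ht) (inv_ne_zero hv)),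
      ?_, ?_⟩ <;>
    simp [UnipG2.torus, ht, hv]
  obtain ⟨e₂, c1, c2, c3, c4, c5⟩ : ∃ e₂ : S ≃* UnipG2 K, (e₂ x).t = 1 ∧ (e₂ x).v₀ = 1 ∧
      (e₂ x).v₁ = 0 ∧ (e₂ x).v₂ = 0 ∧ (e₂ x).v₃ = 0 := by
    refine ⟨e₁.trans (MulAut.conj ⟨0, -(e₁ x).v₁, (-(e₁ x).v₂ + (e₁ x).v₁) / 2,
      (-(e₁ x).v₃ - 3 * ((-(e₁ x).v₂ + (e₁ x).v₁) / 2) + (e₁ x).v₁) / 3, 0, 0⟩),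
      ?_, ?_, ?_, ?_, ?_⟩ <;>
    simp [MulAut.conj_apply, b1, b2]
    · field_simp
      ring
    · field_simp
      ring
  refine ⟨e₂.trans (MulAut.conj ⟨0, 0, 0, 0, (e₂ x).z / 2, 0⟩), ?_⟩
  ext <;> simp [MulAut.conj_apply, c1, c2, c3, c4, c5]
  field_simp
  ring

section Normalized

variable {x : S} (hx : e x = ⟨1, 1, 0, 0, 0, 0⟩)
include hx

theorem regular_commutator_mem_Zc_two_iff {u : S} : ⁅x, u⁆ ∈ Zc S 2 ↔
    (e u).v₀ = (e u).t ∧ (e u).v₁ = ((e u).t ^ 2 - (e u).t) / 2 := by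
  rw [commutator_mem_Zc_two_iff e h2 h3, hx]
  refine ⟨fun ⟨a, b⟩ => ?_, fun ⟨a, b⟩ => ?_⟩
  · have a' : (e u).v₀ = (e u).t := by linear_combination -a
    refine ⟨a', ?_⟩
    field_simp
    linear_combination -b - a'
  · rw [a, b]
    exact ⟨by ring, by field_simp; ring⟩

theorem regular_commutator_mem_Zc_one_iff {u : S} : ⁅x, u⁆ ∈ Zc S 1 ↔
    (e u).v₀ = (e u).t ∧ (e u).v₁ = ((e u).t ^ 2 - (e u).t) / 2 ∧
      (e u).v₂ = (2 * (e u).t ^ 3 - 3 * (e u).t ^ 2 + (e u).t) / (2 * 3) := by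
  rw [commutator_mem_Zc_one_iff e h2 h3, hx]
  refine ⟨fun ⟨a, b, c⟩ => ?_, fun ⟨a, b, c⟩ => ?_⟩
  · have a' : (e u).v₀ = (e u).t := by linear_combination -a
    have b' : 2 * (e u).v₁ = (e u).t ^ 2 - (e u).t := by linear_combination -b - a'
    refine ⟨a', ?_, ?_⟩
    · field_simp
      linear_combination b'
    · field_simp
      linear_combination -2 * c - 3 * b' - 2 * a'
  · rw [a, b, c]
    exact ⟨by ring, by field_simp; ring, by field_simp; ring⟩

theorem regular_commutator_eq_one_iff {u : S} : ⁅x, u⁆ = 1 ↔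
    (e u).v₀ = (e u).t ∧ (e u).v₁ = ((e u).t ^ 2 - (e u).t) / 2 ∧
      (e u).v₂ = (2 * (e u).t ^ 3 - 3 * (e u).t ^ 2 + (e u).t) / (2 * 3) ∧
      (e u).v₃ = (((e u).t ^ 2 - (e u).t) / 2) ^ 2 := by
  have hz : (e (x * u)).z = (e (u * x)).z ↔ 2 * (e u).v₃ = 3 * ((e u).t - 1) * (e u).v₂
      - 3 * ((e u).t ^ 2 + 1) * (e u).v₁ + ((e u).t ^ 3 - 1) * (e u).v₀ := by
    rw [map_mul, map_mul, UnipG2.mul_z, UnipG2.mul_z, hx]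
    constructor <;> intro h <;> linear_combination h
  constructor
  · intro h
    have h1 : ⁅x, u⁆ ∈ Zc S 1 := by rw [h]; exact one_mem _
    obtain ⟨a, b, c⟩ := (regular_commutator_mem_Zc_one_iff e h2 h3 hx).1 h1
    refine ⟨a, b, c, ?_⟩
    have h4 := hz.1 (((commutator_eq_one_iff e x u).1 h).2.2.2)
    rw [a, b, c] at h4
    apply mul_left_cancel₀ h2
    rw [h4]
    field_simp
    ring
  · rintro ⟨a, b, c, d⟩
    have h1 := (regular_commutator_mem_Zc_one_iff e h2 h3 hx).2 ⟨a, b, c⟩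
    rw [commutator_mem_Zc_one_iff e h2 h3] at h1
    refine (commutator_eq_one_iff e x u).2 ⟨h1.1, h1.2.1, h1.2.2, hz.2 ?_⟩
    rw [a, b, c, d]
    field_simp
    ring

/-- The centralizer of a regular element is abelian modulo the centre of `S`. -/
theorem regular_centralizer_mod_center {u w : S} (hu : ⁅x, u⁆ ∈ Zc S 1) (hw : ⁅x, w⁆ ∈ Zc S 1) :
    ⁅u, w⁆ ∈ Zc S 1 := by
  obtain ⟨a, b, c⟩ := (regular_commutator_mem_Zc_one_iff e h2 h3 hx).1 hu
  obtain ⟨a', b', c'⟩ := (regular_commutator_mem_Zc_one_iff e h2 h3 hx).1 hw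
  rw [commutator_mem_Zc_one_iff e h2 h3, a, b, c, a', b', c']
  exact ⟨by ring, by field_simp; ring, by field_simp; ring⟩

/-- The centralizer of a regular element is abelian. -/
theorem regular_centralizer {u w : S} (hu : ⁅x, u⁆ = 1) (hw : ⁅x, w⁆ = 1) : ⁅u, w⁆ = 1 := by
  have h1 := regular_centralizer_mod_center e h2 h3 hx (u := u) (w := w)
    (by rw [hu]; exact one_mem _) (by rw [hw]; exact one_mem _)
  rw [commutator_mem_Zc_one_iff e h2 h3] at h1
  obtain ⟨a, b, c, d⟩ := (regular_commutator_eq_one_iff e h2 h3 hx).1 hu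
  obtain ⟨a', b', c', d'⟩ := (regular_commutator_eq_one_iff e h2 h3 hx).1 hw
  refine (commutator_eq_one_iff e u w).2 ⟨h1.1, h1.2.1, h1.2.2, ?_⟩
  rw [map_mul, map_mul, UnipG2.mul_z, UnipG2.mul_z, a, b, c, d, a', b', c', d']
  field_simp
  ring

end Normalized

variable [Finite S] {p : ℕ} [Fact p.Prime]

/-- A centric radical subgroup which contains a regular element and in which no regular element is
central modulo `Z(S)` is the whole group: every `Zᵢ(S)` is characteristic in `E`, being either the
`i`-th centre of `E` or, for `i ≥ 3`, the intersection `E ∩ Q₂ = C_E(Z₂(S))`. -/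
theorem eq_top_of_regular (hS : IsPGroup p S) (hc : IsCentricIn E) (hr : IsRadicalIn p E) {x : S}
    (hxE : x ∈ E) (hx : e x = ⟨1, 1, 0, 0, 0, 0⟩)
    (hreg : ∀ y ∈ E, (e y).t ≠ 0 → (e y).v₀ ≠ 0 → ¬ ∀ u ∈ E, ⁅y, u⁆ ∈ Zc S 1) : E = ⊤ := by
  have hsucc : ∀ {i : ℕ} {y : S}, y ∈ Zc S (i + 1) → ∀ u : S, ⁅y, u⁆ ∈ Zc S i :=
    fun h u => Subgroup.mem_upperCentralSeries_succ_iff.1 h u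
  have hZ1 := hc.Zc_one_le
  have c0 : IsCharIn E (Zc S 0) := IsCharIn.bot E
  have hc2 : ∀ y ∈ E, (∀ u ∈ E, ⁅y, u⁆ ∈ Zc S 1) → y ∈ Zc S 2 := by
    intro y hy h
    have h' : ⁅x, y⁆ ∈ Zc S 1 := by
      rw [← commutatorElement_inv]; exact inv_mem (h x hxE)
    obtain ⟨a, b, c⟩ := (regular_commutator_mem_Zc_one_iff e h2 h3 hx).1 h'
    have ht : (e y).t = 0 := by
      by_contra ht
      exact hreg y hy ht (a ▸ ht) h
    rw [ht] at a b c
    exact (mem_Zc_two e h2 h3).2 ⟨ht, a, by rw [b]; simp, by rw [c]; simp⟩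
  have c1 : IsCharIn E (Zc S 1) := IsCharIn.of_commutator (IsCharIn.top E) c0 fun y hy => by
    refine ⟨fun h u _ _ => hsucc h u, fun h => ?_⟩
    have h' : ∀ u ∈ E, ⁅y, u⁆ = 1 := fun u hu => Subgroup.mem_bot.1 (h u hu (Subgroup.mem_top u))
    obtain ⟨a1, a2, a3, a4⟩ := (mem_Zc_two e h2 h3).1
      (hc2 y hy fun u hu => by rw [h' u hu]; exact one_mem _)
    have h'' : ⁅x, y⁆ = 1 := by rw [← commutatorElement_inv, h' x hxE, inv_one]
    have a5 := ((regular_commutator_eq_one_iff e h2 h3 hx).1 h'').2.2.2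
    exact (mem_Zc_one e h2 h3).2 ⟨a1, a2, a3, a4, by rw [a5, a1]; simp⟩
  have hZ2 : Zc S 2 ≤ E := fun g hg =>
    mem_of_isCharIn_Zc hS hc hr (j := 1) (fun i hi => by interval_cases i <;> assumption) hZ1
      fun y _ => hsucc hg y
  have c2 : IsCharIn E (Zc S 2) := IsCharIn.of_commutator (IsCharIn.top E) c1 fun y hy =>
    ⟨fun h u _ _ => hsucc h u, fun h => hc2 y hy fun u hu => h u hu (Subgroup.mem_top u)⟩
  have hZ3 : Zc S 3 ≤ E := fun g hg =>
    mem_of_isCharIn_Zc hS hc hr (j := 2) (fun i hi => by interval_cases i <;> assumption) hZ2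
      fun y _ => hsucc hg y
  have hQ2 : ∀ y ∈ E, (∀ u ∈ E, u ∈ Zc S 2 → ⁅y, u⁆ ∈ (⊥ : Subgroup S)) → (e y).v₀ = 0 :=
    fun y hy h => (mem_Q2 e h2 h3).1 (Subgroup.mem_centralizer_iff.2 fun u hu =>
      (commutatorElement_eq_one_iff_mul_comm.1 (Subgroup.mem_bot.1 (h u (hZ2 hu) hu))).symm)
  have hQ2' : ∀ y, (e y).v₀ = 0 → ∀ u ∈ E, u ∈ Zc S 2 → ⁅y, u⁆ ∈ (⊥ : Subgroup S) :=
    fun y hy u _ hu => Subgroup.mem_bot.2 (commutator_of_mem_Q2 hu ((mem_Q2 e h2 h3).2 hy))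
  have c3 : IsCharIn E (Zc S 3) := by
    by_cases h : ∃ y ∈ E, (e y).t ≠ 0 ∧ (e y).v₀ ≠ 0 ∧ ∀ u ∈ E, ⁅y, u⁆ ∈ Zc S 2
    · obtain ⟨y, hy, hyt, hyv, hyu⟩ := h
      refine IsCharIn.of_commutator c2 c0 fun u hu =>
        ⟨fun h => hQ2' u ((mem_Zc_three e h2 h3).1 h).2.1, fun h => ?_⟩
      have hv := hQ2 u hu h
      obtain ⟨a, b⟩ := (commutator_mem_Zc_two_iff e h2 h3).1 (hyu u hu)
      have ht : (e u).t = 0 := by simpa [hv, hyv] using a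
      exact (mem_Zc_three e h2 h3).2 ⟨ht, hv, by simpa [hv, ht, hyt, h2, eq_comm] using b⟩
    · refine IsCharIn.of_commutator (IsCharIn.top E) c2 fun y hy =>
        ⟨fun h u _ _ => hsucc h u, fun h' => ?_⟩
      have h1 : ⁅x, y⁆ ∈ Zc S 2 := by
        rw [← commutatorElement_inv]; exact inv_mem (h' x hxE (Subgroup.mem_top x))
      obtain ⟨a, b⟩ := (regular_commutator_mem_Zc_two_iff e h2 h3 hx).1 h1
      have ht : (e y).t = 0 := by
        by_contra ht
        exact h ⟨y, hy, ht, a ▸ ht, fun u hu => h' u hu (Subgroup.mem_top u)⟩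
      rw [ht] at a b
      exact (mem_Zc_three e h2 h3).2 ⟨ht, a, by rw [b]; simp⟩
  have hZ4 : Zc S 4 ≤ E := fun g hg =>
    mem_of_isCharIn_Zc hS hc hr (j := 3) (fun i hi => by interval_cases i <;> assumption) hZ3
      fun y _ => hsucc hg y
  have c4 : IsCharIn E (Zc S 4) := by
    by_cases h : ∃ y ∈ E, (e y).t ≠ 0 ∧ (e y).v₀ ≠ 0 ∧ ∀ u ∈ E, ⁅y, u⁆ ∈ Zc S 3
    · obtain ⟨y, hy, hyt, hyv, hyu⟩ := h
      refine IsCharIn.of_commutator c2 c0 fun u hu =>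
        ⟨fun h => hQ2' u ((mem_Zc_four e h2 h3).1 h).2, fun h => ?_⟩
      have hv := hQ2 u hu h
      have a := (commutator_mem_Zc_three_iff e h2 h3).1 (hyu u hu)
      exact (mem_Zc_four e h2 h3).2 ⟨by simpa [hv, hyv] using a, hv⟩
    · refine IsCharIn.of_commutator (IsCharIn.top E) c3 fun y hy =>
        ⟨fun h u _ _ => hsucc h u, fun h' => ?_⟩
      have h1 : ⁅x, y⁆ ∈ Zc S 3 := by
        rw [← commutatorElement_inv]; exact inv_mem (h' x hxE (Subgroup.mem_top x))
      have a := (commutator_mem_Zc_three_iff e h2 h3).1 h1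
      simp only [hx, mul_one, one_mul] at a
      have ht : (e y).t = 0 := by
        by_contra ht
        exact h ⟨y, hy, ht, a ▸ ht, fun u hu => h' u hu (Subgroup.mem_top u)⟩
      exact (mem_Zc_four e h2 h3).2 ⟨ht, a ▸ ht⟩
  rw [eq_top_iff]
  exact fun g _ =>
    mem_of_isCharIn_Zc hS hc hr (j := 4) (fun i hi => by interval_cases i <;> assumption) hZ4
      fun y _ => (mem_Zc_four e h2 h3).2 ⟨commutator_t e g y, commutator_v₀ e g y⟩

end Regular

section RegularCases

variable {K S : Type*} [Field K] [Group S] (e : S ≃* UnipG2 K) {E : Subgroup S} [Finite S]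
  {p : ℕ} [Fact p.Prime] [CharP K p] (hp : 5 ≤ p)
include e hp

omit [Finite S] in
/-- In characteristic `5` the regular elements have order `25`. -/
theorem pow_five_eq_one_iff (h5 : p = 5) {y : S} (h : (e y).v₀ = (e y).t) :
    y ^ p = 1 ↔ (e y).t = 0 := by
  constructor
  · intro hy
    subst h5
    have h5 : (5 : K) = 0 := by exact_mod_cast CharP.cast_eq_zero K 5
    have h1 : (e (y ^ 5)).z = 0 := by rw [hy, map_one]; rfl
    rw [map_pow, UnipG2.pow_five h5, h] at h1
    have h2 := two_ne_zero_of_five_le (K := K) hp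
    have h3 : 2 * 2 * ((e y).t ^ 3 * (e y).t ^ 2) = 0 := by linear_combination h1
    simpa [h2] using h3
  · exact fun ht => pow_eq_one_of_mul_eq_zero e hp (by rw [ht, zero_mul])

/-- The centric radical subgroups containing a regular element in their centre. -/
theorem regular_central (hS : IsPGroup p S) (hc : IsCentricIn E) (hr : IsRadicalIn p E) {x : S}
    (hxE : x ∈ E) (hx : e x = ⟨1, 1, 0, 0, 0, 0⟩) (hxc : ∀ u ∈ E, ⁅x, u⁆ = 1) :
    7 ≤ p ∧ IsElemAbelian p E ∧ Nat.card E = Nat.card K ^ 2 ∧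
      Subgroup.center S = E ⊓ Q1 S ∧ E ⊓ Q1 S = E ⊓ Q2 S ∧
      Subgroup.normalizer (E : Set S) = E ⊔ Zc S 2 ∧
      Nat.card (Subgroup.normalizer (E : Set S)) = Nat.card K ^ 3 := by
  have h2 := two_ne_zero_of_five_le (K := K) hp
  have h3 := three_ne_zero_of_five_le (K := K) hp
  have hab : ∀ u ∈ E, ∀ w ∈ E, ⁅u, w⁆ = 1 := fun u hu w hw =>
    regular_centralizer e h2 h3 hx (hxc u hu) (hxc w hw)
  have hmem' : ∀ u, u ∈ E ↔ ⁅x, u⁆ = 1 := fun u => ⟨hxc u, fun hu =>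
    hc.mem_of_commutator fun w hw => regular_centralizer e h2 h3 hx hu (hxc w hw)⟩
  have hmem : ∀ u, u ∈ E ↔ (e u).v₀ = (e u).t ∧ (e u).v₁ = ((e u).t ^ 2 - (e u).t) / 2 ∧
      (e u).v₂ = (2 * (e u).t ^ 3 - 3 * (e u).t ^ 2 + (e u).t) / (2 * 3) ∧
      (e u).v₃ = (((e u).t ^ 2 - (e u).t) / 2) ^ 2 := fun u =>
    (hmem' u).trans (regular_commutator_eq_one_iff e h2 h3 hx)
  have hZ1 : ∀ u ∈ E, u ∈ Zc S 1 ↔ (e u).t = 0 := fun u hu => by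
    obtain ⟨a, b, c, d⟩ := (hmem u).1 hu
    rw [mem_Zc_one e h2 h3]
    refine ⟨fun h => h.1, fun h => ?_⟩
    rw [a, b, c, d, h]
    simp
  have hcomm : ∀ y ∈ Zc S 2, ∀ u ∈ E, ⁅y, u⁆ ∈ Zc S 1 := fun y hy u _ =>
    Subgroup.mem_upperCentralSeries_succ_iff.1 hy u
  have hp5 : p ≠ 5 := by
    intro h5
    have hchar : IsCharIn E (Zc S 1) := IsCharIn.of_pow p fun u hu =>
      (hZ1 u hu).trans (pow_five_eq_one_iff e hp h5 ((hmem u).1 hu).1).symm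
    have hw : e.symm ⟨0, 0, 0, 0, 1, 0⟩ ∈ Zc S 2 := (mem_Zc_two e h2 h3).2 (by simp)
    have hwE : e.symm ⟨0, 0, 0, 0, 1, 0⟩ ∈ E :=
      hr.mem_of_chain_one hS hc hchar
        (mem_normalizer_of_commutator fun u hu => hc.Zc_one_le (hcomm _ hw u hu)) (hcomm _ hw)
        fun u _ hu => commutator_of_mem_center' hu _
    have := ((hmem _).1 hwE).2.2.2
    simp at this
  have hN : ∀ g, g ∈ Subgroup.normalizer (E : Set S) ↔ ⁅x, g⁆ ∈ Zc S 1 := by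
    intro g
    constructor
    · intro hg
      rw [← commutatorElement_inv]
      exact inv_mem ((hZ1 _ (commutator_mem_of_mem_normalizer hg hxE)).2 (commutator_t e g x))
    · intro hg
      refine mem_normalizer_of_commutator fun y hy => hc.Zc_one_le ?_
      exact regular_centralizer_mod_center e h2 h3 hx hg (by rw [hxc y hy]; exact one_mem _)
  have hQ1 : Subgroup.center S = E ⊓ Q1 S := by
    rw [← Subgroup.upperCentralSeries_one]
    ext u
    rw [Subgroup.mem_inf, mem_Q1 e h2 h3]
    exact ⟨fun hu => ⟨hc.Zc_one_le hu, ((mem_Zc_one e h2 h3).1 hu).1⟩,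
      fun ⟨hu, ht⟩ => (hZ1 u hu).2 ht⟩
  refine ⟨seven_le_of_ne_five hp hp5, ⟨fun u hu w hw =>
    commutatorElement_eq_one_iff_mul_comm.1 (hab u hu w hw), fun u _ =>
    pow_eq_one_of_ne_five e hp hp5 u⟩, ?_, hQ1, ?_, le_antisymm (fun g hg => ?_)
    (sup_le Subgroup.le_normalizer fun g hg => ?_), ?_⟩
  · rw [card_eq_of_param e E (fun a : K × K => ⟨a.1, a.1, (a.1 ^ 2 - a.1) / 2,
      (2 * a.1 ^ 3 - 3 * a.1 ^ 2 + a.1) / (2 * 3), ((a.1 ^ 2 - a.1) / 2) ^ 2, a.2⟩), Nat.card_prod]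
    · ring
    · rintro ⟨a, b⟩ ⟨a', b'⟩ h
      exact Prod.ext (congrArg UnipG2.t h) (congrArg UnipG2.z h)
    · intro u
      rw [hmem]
      constructor
      · rintro ⟨a, b, c, d⟩
        exact ⟨((e u).t, (e u).z), UnipG2.ext rfl a.symm b.symm c.symm d.symm rfl⟩
      · rintro ⟨a, ha⟩
        rw [← ha]
        exact ⟨rfl, rfl, rfl, rfl⟩
  · ext u
    rw [Subgroup.mem_inf, Subgroup.mem_inf, mem_Q1 e h2 h3, mem_Q2 e h2 h3]
    exact and_congr_right fun hu => by rw [((hmem u).1 hu).1]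
  · obtain ⟨a, b, c⟩ := (regular_commutator_mem_Zc_one_iff e h2 h3 hx).1 ((hN g).1 hg)
    set w := e.symm ⟨(e g).t, (e g).v₀, (e g).v₁, (e g).v₂,
      (((e g).t ^ 2 - (e g).t) / 2) ^ 2, 0⟩ with hw
    have hwE : w ∈ E := (hmem w).2 (by
      simp only [hw, MulEquiv.apply_symm_apply]
      exact ⟨a, b, c, trivial⟩)
    rw [← mul_inv_cancel_left w g]
    refine mul_mem (Subgroup.mem_sup_left hwE) (Subgroup.mem_sup_right ?_)
    rw [mem_Zc_two e h2 h3]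
    simp only [hw, map_mul, map_inv, MulEquiv.apply_symm_apply, UnipG2.mul_t, UnipG2.mul_v₀,
      UnipG2.mul_v₁, UnipG2.mul_v₂, UnipG2.inv_t, UnipG2.inv_v₀, UnipG2.inv_v₁, UnipG2.inv_v₂]
    refine ⟨?_, ?_, ?_, ?_⟩ <;> ring
  · refine (hN g).2 ?_
    rw [← commutatorElement_inv]
    exact inv_mem (hcomm g hg x hxE)
  · rw [card_eq_of_param e _ (fun a : K × K × K => ⟨a.1, a.1, (a.1 ^ 2 - a.1) / 2,
      (2 * a.1 ^ 3 - 3 * a.1 ^ 2 + a.1) / (2 * 3), a.2.1, a.2.2⟩), Nat.card_prod, Nat.card_prod]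
    · ring
    · rintro ⟨a, b, c⟩ ⟨a', b', c'⟩ h
      exact Prod.ext (congrArg UnipG2.t h) (Prod.ext (congrArg UnipG2.v₃ h) (congrArg UnipG2.z h))
    · intro u
      rw [hN, regular_commutator_mem_Zc_one_iff e h2 h3 hx]
      constructor
      · rintro ⟨a, b, c⟩
        exact ⟨((e u).t, (e u).v₃, (e u).z), UnipG2.ext rfl a.symm b.symm c.symm rfl rfl⟩
      · rintro ⟨a, ha⟩
        rw [← ha]
        exact ⟨rfl, rfl, rfl⟩

omit [Finite S] hp in
/-- Away from characteristic `5`, the centralizer modulo `Z(S)` of a regular element embeds in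
`SL₃(K)`. Its elements are the products of `x ^ s`, defined for `s` in `K` by interpolation of the
coordinates of the powers of `x`, with elements of `Z₂(S)`. -/
theorem exists_hom_SL3 (h2 : (2 : K) ≠ 0) (h3 : (3 : K) ≠ 0) (h60 : (60 : K) ≠ 0)
    (hmem : ∀ u ∈ E, (e u).v₀ = (e u).t ∧ (e u).v₁ = ((e u).t ^ 2 - (e u).t) / 2 ∧
      (e u).v₂ = (2 * (e u).t ^ 3 - 3 * (e u).t ^ 2 + (e u).t) / (2 * 3)) :
    ∃ f : E →* Matrix.SpecialLinearGroup (Fin 3) K, Function.Injective f := by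
  -- the `v₃`- and `z`-coordinates after division by `x ^ t`
  let b : S → K := fun u => (e u).v₃ - (((e u).t ^ 2 - (e u).t) / 2) ^ 2
  let r : K → K := fun s => s * (s - 1) *
    (30 + 70 * (s - 2) + 30 * (s - 2) * (s - 3) + 3 * (s - 2) * (s - 3) * (s - 4)) / 60
  let c : S → K := fun u => -((e u).z + r (e u).t - (e u).t * b u) / 2
  have h4 : (4 : K) ≠ 0 := by
    rw [show (4 : K) = 2 * 2 by norm_num]; exact mul_ne_zero h2 h2
  have hb : ∀ u ∈ E, ∀ w ∈ E, b (u * w) = b u + b w := by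
    intro u hu w hw
    obtain ⟨a1, a2, a3⟩ := hmem u hu
    obtain ⟨b1, b2, b3⟩ := hmem w hw
    simp only [b, map_mul, UnipG2.mul_t, UnipG2.mul_v₃, a1, a2, a3]
    field_simp
    ring
  have hcm : ∀ u ∈ E, ∀ w ∈ E, c (u * w) = c u + c w + b u * (e w).t := by
    intro u hu w hw
    obtain ⟨a1, a2, a3⟩ := hmem u hu
    obtain ⟨b1, b2, b3⟩ := hmem w hw
    simp only [c, hb u hu w hw]
    simp only [b, r, map_mul, UnipG2.mul_t, UnipG2.mul_z, a1, a2, a3, b1, b2, b3]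
    field_simp
    ring
  have hone : b 1 = 0 ∧ c 1 = 0 := by simp [b, c, r]
  refine ⟨{ toFun := fun u => ⟨!![1, b u, c u; 0, 1, (e u).t; 0, 0, 1], by
              simp [Matrix.det_fin_three]⟩
            map_one' := ?_
            map_mul' := ?_ }, ?_⟩
  · ext i j
    fin_cases i <;> fin_cases j <;> simp [hone]
  · rintro ⟨u, hu⟩ ⟨w, hw⟩
    refine Subtype.ext ?_
    change (!![1, b (u * w), c (u * w); 0, 1, (e (u * w)).t; 0, 0, 1] : Matrix (Fin 3) (Fin 3) K) =
      !![1, b u, c u; 0, 1, (e u).t; 0, 0, 1] * !![1, b w, c w; 0, 1, (e w).t; 0, 0, 1]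
    rw [hb u hu w hw, hcm u hu w hw, map_mul, UnipG2.mul_t]
    ext i j
    fin_cases i <;> fin_cases j <;> simp [Matrix.mul_apply, Fin.sum_univ_three] <;> ring
  · rintro ⟨u, hu⟩ ⟨w, hw⟩ h
    have hM := congrArg Subtype.val h
    have ht : (e u).t = (e w).t := congrFun (congrFun hM 1) 2
    have hb' : b u = b w := congrFun (congrFun hM 0) 1
    have hc' : c u = c w := congrFun (congrFun hM 0) 2
    obtain ⟨a1, a2, a3⟩ := hmem u hu
    obtain ⟨b1, b2, b3⟩ := hmem w hw
    refine Subtype.ext (e.injective (UnipG2.ext ht ?_ ?_ ?_ ?_ ?_))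
    · rw [a1, b1, ht]
    · rw [a2, b2, ht]
    · rw [a3, b3, ht]
    · simp only [b, ht] at hb'
      linear_combination hb'
    · simp only [c, hb', ht] at hc'
      field_simp at hc'
      linear_combination -hc'

/-- The centric radical subgroups containing a regular element which is central modulo `Z(S)`, but
not a central one. -/
theorem regular_second_center [Finite K] {n : ℕ} (hK : Nat.card K = p ^ n) (hn : n ≠ 0)
    (hS : IsPGroup p S) (hc : IsCentricIn E) (hr : IsRadicalIn p E) {x : S}
    (hxE : x ∈ E) (hx : e x = ⟨1, 1, 0, 0, 0, 0⟩) (hxc : ∀ u ∈ E, ⁅x, u⁆ ∈ Zc S 1)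
    (hreg : ∀ y ∈ E, (e y).t ≠ 0 → (e y).v₀ ≠ 0 → ¬ ∀ u ∈ E, ⁅y, u⁆ = 1) :
    (∃ T : Sylow p (Matrix.SpecialLinearGroup (Fin 3) K), Nonempty (E ≃* T)) ∧
      Zc S 2 = E ⊓ Q1 S ∧ E ⊓ Q1 S = E ⊓ Q2 S ∧
      Subgroup.center S = centerIn E ∧ centerIn E = frattiniIn E := by
  have h2 := two_ne_zero_of_five_le (K := K) hp
  have h3 := three_ne_zero_of_five_le (K := K) hp
  have hcen : ∀ y, y ∈ Zc S 1 ↔ y ∈ E ∧ ∀ u ∈ E, ⁅y, u⁆ = 1 := by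
    intro y
    refine ⟨fun hy => ⟨hc.Zc_one_le hy, fun u _ => commutator_of_mem_center hy u⟩,
      fun ⟨hy, h⟩ => ?_⟩
    have h' : ⁅x, y⁆ = 1 := by rw [← commutatorElement_inv, h x hxE, inv_one]
    obtain ⟨a, b, c, d⟩ := (regular_commutator_eq_one_iff e h2 h3 hx).1 h'
    have ht : (e y).t = 0 := by
      by_contra ht
      exact hreg y hy ht (a ▸ ht) h
    rw [mem_Zc_one e h2 h3, a, b, c, d, ht]
    simp
  have hchar1 : IsCharIn E (Zc S 1) :=
    IsCharIn.of_commutator (IsCharIn.top E) (IsCharIn.bot E) fun y hy => by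
      rw [hcen y]
      simp [hy]
  have hstep : ∀ w : S, (∀ u ∈ E, ⁅w, u⁆ ∈ Zc S 1) → w ∈ E := fun w hw =>
    hr.mem_of_chain_one hS hc hchar1
      (mem_normalizer_of_commutator fun u hu => hc.Zc_one_le (hw u hu)) hw
      fun u _ hu => commutator_of_mem_center' hu _
  have hZ2 : Zc S 2 ≤ E := fun w hw => hstep w fun u _ =>
    Subgroup.mem_upperCentralSeries_succ_iff.1 hw u
  have hmem' : ∀ u, u ∈ E ↔ ⁅x, u⁆ ∈ Zc S 1 := fun u => ⟨hxc u, fun hu => hstep u fun w hw =>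
    regular_centralizer_mod_center e h2 h3 hx hu (hxc w hw)⟩
  have hmem : ∀ u, u ∈ E ↔ (e u).v₀ = (e u).t ∧ (e u).v₁ = ((e u).t ^ 2 - (e u).t) / 2 ∧
      (e u).v₂ = (2 * (e u).t ^ 3 - 3 * (e u).t ^ 2 + (e u).t) / (2 * 3) := fun u =>
    (hmem' u).trans (regular_commutator_mem_Zc_one_iff e h2 h3 hx)
  have hmem2 : ∀ u ∈ E, u ∈ Zc S 2 ↔ (e u).t = 0 := fun u hu => by
    obtain ⟨a, b, c⟩ := (hmem u).1 hu
    rw [mem_Zc_two e h2 h3]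
    refine ⟨fun h => h.1, fun h => ?_⟩
    rw [a, b, c, h]
    simp
  have hp5 : p ≠ 5 := by
    intro h5
    have hchar2 : IsCharIn E (Zc S 2) := IsCharIn.of_pow p fun u hu =>
      (hmem2 u hu).trans (pow_five_eq_one_iff e hp h5 ((hmem u).1 hu).1).symm
    have hw : e.symm ⟨0, 0, 0, 1, 0, 0⟩ ∈ Zc S 3 := (mem_Zc_three e h2 h3).2 (by simp)
    have hwE : e.symm ⟨0, 0, 0, 1, 0, 0⟩ ∈ E :=
      mem_of_isCharIn_Zc hS hc hr (j := 2)
        (fun i hi => by interval_cases i; exacts [IsCharIn.bot E, hchar1, hchar2]) hZ2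
        fun u _ => Subgroup.mem_upperCentralSeries_succ_iff.1 hw u
    have := ((hmem _).1 hwE).2.2
    simp at this
  have hcard : Nat.card E = (p ^ n) ^ 3 := by
    rw [card_eq_of_param e E (fun a : K × K × K => ⟨a.1, a.1, (a.1 ^ 2 - a.1) / 2,
      (2 * a.1 ^ 3 - 3 * a.1 ^ 2 + a.1) / (2 * 3), a.2.1, a.2.2⟩), Nat.card_prod, Nat.card_prod, hK]
    · ring
    · rintro ⟨a, b, c⟩ ⟨a', b', c'⟩ h
      exact Prod.ext (congrArg UnipG2.t h) (Prod.ext (congrArg UnipG2.v₃ h) (congrArg UnipG2.z h))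
    · intro u
      rw [hmem]
      constructor
      · rintro ⟨a, b, c⟩
        exact ⟨((e u).t, (e u).v₃, (e u).z), UnipG2.ext rfl a.symm b.symm c.symm rfl rfl⟩
      · rintro ⟨a, ha⟩
        rw [← ha]
        exact ⟨rfl, rfl, rfl⟩
  have hcE : Zc S 1 = centerIn E := by
    ext y
    rw [hcen y, mem_centerIn]
    exact and_congr_right fun _ => forall₂_congr fun u _ => by
      rw [commutatorElement_eq_one_iff_mul_comm, eq_comm]
  obtain ⟨f, hf⟩ := exists_hom_SL3 e h2 h3 (sixty_ne_zero hp hp5) fun u hu => (hmem u).1 hu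
  refine ⟨exists_mulEquiv_sylow_SL3 hK hn f hf hcard, ?_, ?_, ?_, ?_⟩
  · ext u
    rw [Subgroup.mem_inf, mem_Q1 e h2 h3]
    exact ⟨fun hu => ⟨hZ2 hu, ((mem_Zc_two e h2 h3).1 hu).1⟩, fun ⟨hu, ht⟩ => (hmem2 u hu).2 ht⟩
  · ext u
    rw [Subgroup.mem_inf, Subgroup.mem_inf, mem_Q1 e h2 h3, mem_Q2 e h2 h3]
    exact and_congr_right fun hu => by rw [((hmem u).1 hu).1]
  · rw [← hcE, Zc, Subgroup.upperCentralSeries_one]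
  · rw [← hcE]
    refine (frattiniIn_eq hS E _ (fun y hy => ?_) (fun a ha b hb => ?_) fun a _ =>
      pow_mem_Zc_one e hp a).symm
    · have hx0 : (e x).v₀ ≠ 0 := by rw [hx]; exact one_ne_zero
      exact ⟨x, hxE, _, hZ2 ((mem_Zc_two e h2 h3).2 (by simp)),
        mem_Zc_one_eq_commutator e h2 h3 hy hx0⟩
    · exact regular_centralizer_mod_center e h2 h3 hx (hxc a ha) (hxc b hb)

end RegularCases

/-! ### The classification -/

theorem mainTheorem10 (p n q : ℕ) [Fact p.Prime] (hp : 5 ≤ p) (hq : q = p ^ n)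
    (K : Type*) [Field K] [Finite K] (hK : Nat.card K = q)
    (S : Type*) [Group S] (hS : ∃ P : Sylow p (G2 K), Nonempty (S ≃* P))
    (E : Subgroup S) (hcentric : IsCentricIn E) (hradical : IsRadicalIn p E) :
    (E = Q1 S ∨ E = Q2 S ∨ E = ⊤) ∨
    (E ≤ Q2 S ∧ Nat.card E = q ^ 4 ∧ frattiniIn E < Zc S 2 ∧ Zc S 2 = centerIn E ∧
      Nat.card (frattiniIn E) = q ∧ Subgroup.normalizer (E : Set S) = Q2 S) ∨
    (E ≤ commutator S ∧ IsElemAbelian p E ∧ Nat.card E = q ^ 3 ∧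
      (E = Zc S 3 → E.Normal) ∧
      (E ≠ Zc S 3 → Subgroup.normalizer (E : Set S) = Q1 S)) ∨
    (E ≤ Q2 S ∧ IsElemAbelian p E ∧ Nat.card E = q ^ 3 ∧ ¬ E ≤ commutator S ∧
      Subgroup.normalizer (E : Set S) = E ⊔ Zc S 3 ∧
      Nat.card (Subgroup.normalizer (E : Set S)) = q ^ 4) ∨
    ((∃ T : Sylow p (Matrix.SpecialLinearGroup (Fin 3) K), Nonempty (E ≃* T)) ∧
      Zc S 2 = E ⊓ Q1 S ∧ E ⊓ Q1 S = E ⊓ Q2 S ∧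
      Subgroup.center S = centerIn E ∧ centerIn E = frattiniIn E) ∨
    (E ≤ Q1 S ∧ IsElemAbelian p E ∧ Nat.card E = q ^ 3 ∧ E ⊓ Zc S 2 = Subgroup.center S ∧
      Subgroup.normalizer (E : Set S) = Q1 S) ∨
    (7 ≤ p ∧ IsElemAbelian p E ∧ Nat.card E = q ^ 2 ∧
      Subgroup.center S = E ⊓ Q1 S ∧ E ⊓ Q1 S = E ⊓ Q2 S ∧
      Subgroup.normalizer (E : Set S) = E ⊔ Zc S 2 ∧
      Nat.card (Subgroup.normalizer (E : Set S)) = q ^ 3) := by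
  have hKp : Nat.card K = p ^ n := hK.trans hq
  have hn : n ≠ 0 := by
    rintro rfl
    exact (Finite.one_lt_card (α := K)).ne' hKp
  have hchar : CharP K p := by
    have := Fintype.ofFinite K
    obtain ⟨r, hr⟩ := CharP.exists K
    obtain ⟨m, hrp, hm⟩ := FiniteField.card K r
    rw [← Nat.card_eq_fintype_card, hKp] at hm
    have : r = p := ((Nat.prime_dvd_prime_iff_eq (Fact.out : p.Prime) hrp).1
      ((Fact.out : p.Prime).dvd_of_dvd_pow (hm ▸ dvd_pow_self p hn))).symm
    exact this ▸ hr
  have h2 := two_ne_zero_of_five_le (K := K) hp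
  have h3 := three_ne_zero_of_five_le (K := K) hp
  obtain ⟨P, ⟨eP⟩⟩ := hS
  obtain ⟨eU⟩ := exists_mulEquiv_unipG2 hKp h2 P
  let e : S ≃* UnipG2 K := eP.trans eU
  have : Finite S := Finite.of_equiv _ e.symm.toEquiv
  have hSp : IsPGroup p S := IsPGroup.of_card (n := n * 6) (by
    rw [Nat.card_congr e.toEquiv, UnipG2.card, hKp, pow_mul])
  rw [← hK]
  by_cases hE1 : E ≤ Q1 S
  · by_cases hab : ∀ a ∈ E, ∀ b ∈ E, ⁅a, b⁆ = 1
    · have hel : IsElemAbelian p E :=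
        ⟨fun a ha b hb => commutatorElement_eq_one_iff_mul_comm.1 (hab a ha b hb), fun a ha =>
          pow_eq_one_of_mul_eq_zero e hp (by rw [(mem_Q1 e h2 h3).1 (hE1 ha), zero_mul])⟩
      have hcard := card_of_abelian e h2 h3 hcentric hE1 hab
      by_cases hEc : E ≤ commutator S
      · exact Or.inr (Or.inr (Or.inl ⟨hEc, hel, hcard, fun h => h ▸ inferInstance,
          normalizer_of_abelian e h2 h3 hcentric hE1 hab⟩))
      · refine Or.inr (Or.inr (Or.inr (Or.inr (Or.inr (Or.inl ⟨hE1, hel, hcard,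
          inf_Zc_two_of_abelian e h2 h3 hcentric hE1 hab hEc,
          normalizer_of_abelian e h2 h3 hcentric hE1 hab fun h => hEc fun y hy => ?_⟩)))))
        obtain ⟨a, b, -⟩ := (mem_Zc_three e h2 h3).1 (h ▸ hy)
        exact (mem_commutator_iff e h2 h3).2 ⟨a, b⟩
    · push Not at hab
      obtain ⟨a, ha, b, hb, hab⟩ := hab
      exact Or.inl (Or.inl (eq_Q1_of_not_abelian e hSp h2 h3 hcentric hradical hE1 ha hb hab))
  obtain ⟨x, hx, hx1⟩ := Set.not_subset.1 hE1
  have hxt : (e x).t ≠ 0 := fun h => hx1 ((mem_Q1 e h2 h3).2 h)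
  by_cases hE2 : E ≤ Q2 S
  · obtain ⟨e', hxt', hxv1, hxv2⟩ :=
      exists_conj_coord_Q2 e h2 hxt ((mem_Q2 e h2 h3).1 (hE2 hx))
    have hpow : ∀ a ∈ E, a ^ p = 1 := fun a ha =>
      pow_eq_one_of_mul_eq_zero e hp (by rw [(mem_Q2 e h2 h3).1 (hE2 ha), mul_zero])
    by_cases hv1 : ∀ y ∈ E, (e' y).v₁ = 0
    · by_cases hab : ∀ a ∈ E, ∀ b ∈ E, ⁅a, b⁆ = 1
      · exact Or.inr (Or.inr (Or.inr (Or.inl ⟨hE2, ⟨fun a ha b hb =>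
          commutatorElement_eq_one_iff_mul_comm.1 (hab a ha b hb), hpow⟩,
          (abelian_in_Q2 e' h2 h3 hcentric hE2 hx hxt' hxv2 hv1 hab).1,
          fun h => hxt ((mem_commutator_iff e h2 h3).1 (h hx)).1,
          (abelian_in_Q2 e' h2 h3 hcentric hE2 hx hxt' hxv2 hv1 hab).2⟩)))
      · exact Or.inr (Or.inl ⟨hE2, nonabelian_in_Q2 e' h2 h3 hSp hpow
          (mem_iff_of_line e' h2 h3 hSp hcentric hradical hE2 hx hxt' hxv2 hv1 hab)⟩)
    · push Not at hv1
      obtain ⟨g, hg, hg1⟩ := hv1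
      exact Or.inl (Or.inr (Or.inl
        (eq_Q2_of_not_line e' h2 h3 hSp hcentric hradical hE2 hx hxt' hxv1 hg hg1)))
  -- a group is not the union of two proper subgroups
  obtain ⟨w, hw, hwt, hwv⟩ : ∃ w ∈ E, (e w).t ≠ 0 ∧ (e w).v₀ ≠ 0 := by
    obtain ⟨y, hy, hy2⟩ := Set.not_subset.1 hE2
    have hyv : (e y).v₀ ≠ 0 := fun h => hy2 ((mem_Q2 e h2 h3).2 h)
    by_cases hxv : (e x).v₀ = 0
    · by_cases hyt : (e y).t = 0
      · exact ⟨x * y, mul_mem hx hy, by simp [hyt, hxt], by simp [hxv, hyv]⟩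
      · exact ⟨y, hy, hyt, hyv⟩
    · exact ⟨x, hx, hxt, hxv⟩
  by_cases hc1 : ∃ y ∈ E, (e y).t ≠ 0 ∧ (e y).v₀ ≠ 0 ∧ ∀ u ∈ E, ⁅y, u⁆ = 1
  · obtain ⟨y, hy, hyt, hyv, hyc⟩ := hc1
    obtain ⟨e', he'⟩ := exists_coord_of_regular e h2 h3 hyt hyv
    exact Or.inr (Or.inr (Or.inr (Or.inr (Or.inr (Or.inr
      (regular_central e' hp hSp hcentric hradical hy he' hyc))))))
  have hreg : ∀ (e' : S ≃* UnipG2 K) (y : S), (e' y).t ≠ 0 → (e' y).v₀ ≠ 0 →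
      (e y).t ≠ 0 ∧ (e y).v₀ ≠ 0 := fun e' y ht hv => by
    constructor
    · rwa [Ne, ← mem_Q1 e h2 h3, mem_Q1 e' h2 h3]
    · rwa [Ne, ← mem_Q2 e h2 h3, mem_Q2 e' h2 h3]
  by_cases hc2 : ∃ y ∈ E, (e y).t ≠ 0 ∧ (e y).v₀ ≠ 0 ∧ ∀ u ∈ E, ⁅y, u⁆ ∈ Zc S 1
  · obtain ⟨y, hy, hyt, hyv, hyc⟩ := hc2
    obtain ⟨e', he'⟩ := exists_coord_of_regular e h2 h3 hyt hyv
    exact Or.inr (Or.inr (Or.inr (Or.inr (Or.inl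
      (regular_second_center e' hp hKp hn hSp hcentric hradical hy he' hyc fun u hu ht hv h =>
        hc1 ⟨u, hu, (hreg e' u ht hv).1, (hreg e' u ht hv).2, h⟩)))))
  obtain ⟨e', he'⟩ := exists_coord_of_regular e h2 h3 hwt hwv
  exact Or.inl (Or.inr (Or.inr (eq_top_of_regular e' h2 h3 hSp hcentric hradical hw he'
    fun u hu ht hv h => hc2 ⟨u, hu, (hreg e' u ht hv).1, (hreg e' u ht hv).2, h⟩)))
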